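/- Let $\langle \mathbf z,\mathbf w\rangle=z_1\overline{w_3}+z_2\overline{w_2}+z_3\overline{w_1}$ on $\mathbb C^3$, and let $\partial\mathbf H^2_{\mathbb C}$ (a 3-sphere) be the set of complex lines in $\mathbb C^3$ spanned by nonzero vectors $\mathbf p$ (lifts) with $\langle\mathbf p,\mathbf p\rangle=0$. Write $\infty$ for the point with lift $(1,0,0)$ and $(z,t)\in\mathbb C\times\mathbb R$ for the point with lift $(-|z|^2+it,\sqrt2\,z,1)$. The holomorphic isometries are the elements of $\mathrm{PU}(2,1)$, the group of transformations of $\partial\mathbf H^2_{\mathbb C}$ induced by $\mathrm{SU}(2,1)$; conjugate means conjugate in $\mathrm{PU}(2,1)$. The rotation in an angle $\phi$ is $(z,t)\mapsto(ze^{i\phi},t)$, $\infty\mapsto\infty$; the dilation by $r>0$ is $(z,t)\mapsto(rz,r^2t)$, $\infty\mapsto\infty$. A $\mathbb C$-circle is the set of boundary points contained in a two-dimensional complex subspace of $\mathbb C^3$ on which $\langle\cdot,\cdot\rangle$ takes a negative value $\langle \mathbf v,\mathbf v\rangle<0$. Put $$\mathbb X(p_1,p_2,p_3,p_4)=\frac{\langle\mathbf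 p_3,\mathbf p_1\rangle\langle\mathbf p_4,\mathbf p_2\rangle}{\langle\mathbf p_4,\mathbf p_1\rangle\langle\mathbf p_3,\mathbf p_2\rangle},\qquad \mathbb A(p_1,p_2,p_3)=\arg\bigl(-\langle\mathbf p_1,\mathbf p_2\rangle\langle\mathbf p_2,\mathbf p_3\rangle\langle\mathbf p_3,\mathbf p_1\rangle\bigr)\in[-\tfrac\pi2,\tfrac\pi2],$$ and, for a quadruple $\mathfrak p=(p_1,p_2,p_3,p_4)$ of pairwise distinct points, $\mathbb X_1=\mathbb X(p_1,p_2,p_3,p_4)$, $\mathbb X_2=\mathbb X(p_1,p_3,p_2,p_4)$, $\mathbb X_3=\mathbb X(p_2,p_3,p_1,p_4)$, $\mathbb A_1=\mathbb A(p_2,p_3,p_4)$, $\mathbb A_3=\mathbb A(p_1,p_2,p_4)$, $\mathbb A_4=\mathbb A(p_1,p_2,p_3)$. Let $\mathcal T(x_1,x_2,x_3)=(x_1,x_2,\overline{x_3})$. Every real number is regarded as an argument of $0$. Call $\mathfrak p$ *normalised* if $p_2=\infty$, $p_3=(0,0)$, $$p_1=\bigl(\sqrt{\cos\mathbb A_4}\,e^{-i\mathbb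 A_3},\ \sin\mathbb A_4\bigr),\qquad p_4=\bigl(-\sqrt{\cos\mathbb A_1}\,|\mathbb X_3|^{1/2}e^{i\beta},\ |\mathbb X_3|\sin\mathbb A_1\bigr)$$ for some argument $\beta$ of $1-\mathbb X_1-\mathbb X_2$. **Theorem.** Let $\mathfrak p$ and $\mathfrak p'$ be two quadruples of pairwise distinct points of $\partial\mathbf H^2_{\mathbb C}$ with cross-ratios $\mathbb X_i$ and $\mathbb X_i'$, $i=1,2,3$. Assume that neither of them is contained in a $\mathbb C$-circle and that $\Im\mathbb X_3\ne0$ and $\Im\mathbb X_3'\neq0$. Then each of $\mathfrak p,\mathfrak p'$ can be mapped by an element of $\mathrm{PU}(2,1)$ to a normalised quadruple. Moreover, let $\mathfrak q=(q_1,\dots,q_4)$ and $\mathfrak q'=(q_1',\dots,q_4')$ be any normalised quadruples that are $\mathrm{PU}(2,1)$-images of $\mathfrak p$ and $\mathfrak p'$ respectively. Then $$\mathcal T(\mathbb X_1,\mathbb X_2,\mathbb X_3)=(\mathbb X_1',\mathbb X_2',\mathbb X_3')$$ if and only if there exist holomorphic isometries $g_1,g_4$ such that 1. $g_i(q_2)=q_2'$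 and $g_i(q_3)=q_3'$ for $i=1,4$, $g_1(q_1)=q_4'$ and $g_4(q_4)=q_1'$; 2. $g_1\circ g_4$ is conjugate to the rotation in the angle $\arg\mathbb X_3$; 3. $g_1\circ g_4^{-1}$ is conjugate to the dilation by $|\mathbb X_3|$ followed by the rotation in an angle $2\varphi$, where $\varphi$ is an argument of $\dfrac{1-\mathbb X_1-\mathbb X_2}{\mathbb X_1^{1/2}\mathbb X_2^{1/2}}$ (principal square roots; if $\mathbb X_1+\mathbb X_2=1$, then $\varphi$ may be any real number). -/

import Mathlib

open scoped LinearAlgebra.Projectivization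

namespace ComplexHyperbolic

/-- The Hermitian form `⟨z, w⟩ = z₁ w̄₃ + z₂ w̄₂ + z₃ w̄₁` of signature `(2,1)` on `ℂ³`. -/
noncomputable def herm (z w : Fin 3 → ℂ) : ℂ :=
  z 0 * star (w 2) + z 1 * star (w 1) + z 2 * star (w 0)

theorem herm_smul (a b : ℂ) (z w : Fin 3 → ℂ) :
    herm (a • z) (b • w) = a * star b * herm z w := by
  simp [herm]; ring

/-- `SU(2,1)`: the complex `3 × 3` matrices of determinant one that preserve the form. -/
def SU21 : Subgroup (Matrix.SpecialLinearGroup (Fin 3) ℂ) where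
  carrier := {A | ∀ z w : Fin 3 → ℂ, herm (A • z) (A • w) = herm z w}
  one_mem' := by intro z w; simp
  mul_mem' := by
    intro A B hA hB z w
    rw [mul_smul, mul_smul, hA, hB]
  inv_mem' := by
    intro A hA z w
    rw [← hA (A⁻¹ • z) (A⁻¹ • w), smul_inv_smul, smul_inv_smul]

/-- The boundary `∂H²_ℂ = ℙ(V₀)`: the complex lines in `ℂ³` spanned by a nonzero null vector. -/
def Boundary : Type := {p : ℙ ℂ (Fin 3 → ℂ) // herm p.rep p.rep = 0}

theorem herm_rep_mk (v : Fin 3 → ℂ) (hv : v ≠ 0) (h : herm v v = 0) :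
    herm (Projectivization.mk ℂ v hv).rep (Projectivization.mk ℂ v hv).rep = 0 := by
  obtain ⟨a, ha⟩ := Projectivization.exists_smul_eq_mk_rep ℂ v hv
  rw [← ha, Units.smul_def, herm_smul, h, mul_zero]

namespace Boundary

/-- A lift of a boundary point to a nonzero null vector. -/
noncomputable def lift (p : Boundary) : Fin 3 → ℂ := p.1.rep

/-- The boundary point spanned by a nonzero null vector. -/
noncomputable def ofNull (v : Fin 3 → ℂ) (hv : v ≠ 0) (h : herm v v = 0) : Boundary :=
  ⟨Projectivization.mk ℂ v hv, herm_rep_mk v hv h⟩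

end Boundary

/-- The projective action of `SU(2,1)` on the boundary. -/
noncomputable instance : MulAction SU21 Boundary where
  smul A p := ⟨(A : Matrix.SpecialLinearGroup (Fin 3) ℂ) • p.1, by
    have e : (A : Matrix.SpecialLinearGroup (Fin 3) ℂ) • p.1 =
        Projectivization.mk ℂ ((A : Matrix.SpecialLinearGroup (Fin 3) ℂ) • p.1.rep)
          ((smul_ne_zero_iff_ne _).mpr p.1.rep_nonzero) := by
      conv_lhs => rw [← Projectivization.mk_rep p.1]
      rfl
    rw [e]
    exact herm_rep_mk _ _ ((A.2 _ _).trans p.2)⟩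
  one_smul p := Subtype.ext (one_smul _ p.1)
  mul_smul A B p := Subtype.ext (mul_smul (A : Matrix.SpecialLinearGroup (Fin 3) ℂ)
    (B : Matrix.SpecialLinearGroup (Fin 3) ℂ) p.1)

/-- `PU(2,1)`, the group of holomorphic isometries, realised as the group of the transformations
of the boundary that are induced by elements of `SU(2,1)`. An element of `SU(2,1)` acts trivially
on the boundary exactly if it is a scalar matrix `1`, `ω` or `ω²` with `ω³ = 1`, so this is
`SU(2,1)` modulo these scalars. -/
noncomputable def PU21 : Subgroup (Equiv.Perm Boundary) := (MulAction.toPermHom SU21 Boundary).range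

/-! ### Heisenberg coordinates -/

/-- The point at infinity, spanned by `(1, 0, 0)`. -/
noncomputable def infty : Boundary :=
  Boundary.ofNull ![1, 0, 0] (by intro h; simpa using congrFun h 0) (by simp [herm])

/-- The finite boundary point with Heisenberg coordinates `(z, t)`: its standard lift is
`(-|z|² + i t, √2 z, 1)`. -/
noncomputable def heis (z : ℂ) (t : ℝ) : Boundary :=
  Boundary.ofNull ![-(‖z‖ : ℂ) ^ 2 + t * Complex.I, (Real.sqrt 2 : ℂ) * z, 1]
    (by intro h; simpa using congrFun h 2)
    (by
      have h2 : (Real.sqrt 2 : ℂ) * (Real.sqrt 2 : ℂ) = 2 := by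
        rw [← Complex.ofReal_mul, Real.mul_self_sqrt (by norm_num)]; norm_num
      have hz : z * (starRingEnd ℂ) z = (‖z‖ : ℂ) ^ 2 := Complex.mul_conj' z
      simp [herm]
      linear_combination (z * (starRingEnd ℂ) z) * h2 + 2 * hz)

/-- The Heisenberg coordinate `z ∈ ℂ` of a finite boundary point. -/
noncomputable def zCoord (p : Boundary) : ℂ := p.lift 1 / ((Real.sqrt 2 : ℂ) * p.lift 2)

/-- The Heisenberg coordinate `t ∈ ℝ` of a finite boundary point. -/
noncomputable def tCoord (p : Boundary) : ℝ := (p.lift 0 / p.lift 2).im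

open Classical in
/-- The rotation `(z, t) ↦ (z e^{iφ}, t)`, extended by `∞ ↦ ∞`. -/
noncomputable def heisRotation (φ : ℝ) (p : Boundary) : Boundary :=
  if p = infty then infty else heis (zCoord p * Complex.exp (φ * Complex.I)) (tCoord p)

open Classical in
/-- The dilation `(z, t) ↦ (r z, r² t)`, extended by `∞ ↦ ∞`. -/
noncomputable def heisDilation (r : ℝ) (p : Boundary) : Boundary :=
  if p = infty then infty else heis (r * zCoord p) (r ^ 2 * tCoord p)

/-- A holomorphic isometry is conjugate in `PU(2,1)` to the transformation `f` of the boundary. -/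
def IsConjugateTo (g : PU21) (f : Boundary → Boundary) : Prop :=
  ∃ h : PU21, ∀ x : Boundary, ((h * g * h⁻¹ : PU21) : Equiv.Perm Boundary) x = f x

/-! ### Invariants -/

/-- A `ℂ`-circle: the boundary of a complex line of `H²_ℂ`, that is, the set of the boundary points
whose lifts lie in a two-dimensional complex subspace containing a negative vector. -/
def IsCCircle (C : Set Boundary) : Prop :=
  ∃ W : Submodule ℂ (Fin 3 → ℂ), Module.finrank ℂ W = 2 ∧ (∃ v ∈ W, (herm v v).re < 0) ∧
    C = {p : Boundary | p.lift ∈ W}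

/-- Cartan's angular invariant of three boundary points. -/
noncomputable def cartan (p₁ p₂ p₃ : Boundary) : ℝ :=
  Complex.arg (-(herm p₁.lift p₂.lift * herm p₂.lift p₃.lift * herm p₃.lift p₁.lift))

/-- The complex cross-ratio of four boundary points. -/
noncomputable def crossRatio (p₁ p₂ p₃ p₄ : Boundary) : ℂ :=
  (herm p₃.lift p₁.lift * herm p₄.lift p₂.lift) /
    (herm p₄.lift p₁.lift * herm p₃.lift p₂.lift)

/-! A quadruple `(p₁, p₂, p₃, p₄)` is a map `p : Fin 4 → Boundary` with `p₁ = p 0`, …,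
`p₄ = p 3`. -/

noncomputable def X₁ (p : Fin 4 → Boundary) : ℂ := crossRatio (p 0) (p 1) (p 2) (p 3)

noncomputable def X₂ (p : Fin 4 → Boundary) : ℂ := crossRatio (p 0) (p 2) (p 1) (p 3)

noncomputable def X₃ (p : Fin 4 → Boundary) : ℂ := crossRatio (p 1) (p 2) (p 0) (p 3)

noncomputable def A₁ (p : Fin 4 → Boundary) : ℝ := cartan (p 1) (p 2) (p 3)

noncomputable def A₃ (p : Fin 4 → Boundary) : ℝ := cartan (p 0) (p 1) (p 3)

noncomputable def A₄ (p : Fin 4 → Boundary) : ℝ := cartan (p 0) (p 1) (p 2)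

/-- The involution `𝒯` of the cross-ratio variety, as a map on triples of complex numbers. -/
noncomputable def involutionT (x : ℂ × ℂ × ℂ) : ℂ × ℂ × ℂ := (x.1, x.2.1, star x.2.2)

/-- Two quadruples define the same point of the `PU(2,1)`-configuration space. -/
def SameConfiguration (p q : Fin 4 → Boundary) : Prop :=
  ∃ h : PU21, ∀ i, (h : Equiv.Perm Boundary) (p i) = q i

/-- `φ` is an argument of `z`; every real number is an argument of `0`. -/
def IsArgument (φ : ℝ) (z : ℂ) : Prop := z = ‖z‖ * Complex.exp (φ * Complex.I)

/-- The normal form of a quadruple: `p₂ = ∞`, `p₃ = (0, 0)`, `p₁ = (√(cos A₄) e^{-i A₃}, sin A₄)`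
and `p₄ = (-√(cos A₁) |X₃|^{1/2} e^{iβ}, |X₃| sin A₁)` with `β = arg (1 - X₁ - X₂)`. -/
def IsNormalised (p : Fin 4 → Boundary) : Prop :=
  p 1 = infty ∧ p 2 = heis 0 0 ∧
  p 0 = heis ((Real.sqrt (Real.cos (A₄ p)) : ℂ) * Complex.exp (-(A₃ p) * Complex.I))
    (Real.sin (A₄ p)) ∧
  ∃ β : ℝ, IsArgument β (1 - X₁ p - X₂ p) ∧
    p 3 = heis (-((Real.sqrt (Real.cos (A₁ p)) : ℂ) * (Real.sqrt ‖X₃ p‖ : ℂ) *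
      Complex.exp (β * Complex.I))) (‖X₃ p‖ * Real.sin (A₁ p))

end ComplexHyperbolic

open ComplexHyperbolic

namespace ComplexHyperbolic

open Complex Matrix
open scoped ComplexConjugate

/-! Put `p₂ = ∞`, `p₃ = (0, 0)`, `p₁ = (z, t)`, `p₄ = (w, s)`, with heights `a₁`, `a₄` (the first
coordinates of the standard lifts) and `H = a₄ + 2 w z̄ + ā₁`. Then `X₁ = ā₁ / H`, `X₂ = a₄ / H`,
`X₃ = a₄ / a₁` and `1 - X₁ - X₂ = 2 w z̄ / H`. The normal form amounts to two conditions: `|a₁| =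
1`, and `z` has the phase of `-H̄`. They can be reached because the stabiliser of `∞` and `(0, 0)`
consists of the stretches `(z, t) ↦ (l z, |l|² t)` with `l ≠ 0`.

Hence `g₁`, `g₄` are stretches by some `l₁`, `l₄`, and conditions 2 and 3 become conditions on `l₁
l₄` and `l₁ / l₄`. The converse half needs a stretch factor to be determined by its conjugacy class
as far as it is used: `IsConjugateTo.norm_eq_one` and `IsConjugateTo.eq_of_norm_eq`.

Write `R = |X₃| = |a₄|`. Given the pairings, `|l₁|² = R = |l₄|⁻²` and `l₁ / l₄ = e^{2iφ} R`. The
second quadruple therefore has heights `a₄ / R` and `R a₁`, and `heisProd_transform` gives `H' ā₁ a₄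
= R H`; the relation `𝒯` follows (`IsStandard.involution_eq`).

Conversely, the cross-ratio equations determine the heights of the second quadruple up to a common
sign. Heights have nonpositive real part, so the wrong sign would make both heights of the first
quadruple imaginary and `X₃` real (`height_eq_of_involution`). The phase conditions then yield
factors with the required product and quotient (`exists_stretch_factors`,
`IsStandard.exists_pairing`). -/

/-- The vector `v` spans the boundary point `p`. -/
def Spans (v : Fin 3 → ℂ) (p : Boundary) : Prop := ∃ c : ℂ, c ≠ 0 ∧ p.lift = c • v

/-! ### Spanning vectors and invariants computed from arbitrary lifts. -/

theorem Boundary.lift_ne_zero (p : Boundary) : p.lift ≠ 0 := p.1.rep_nonzero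

theorem Boundary.herm_lift (p : Boundary) : herm p.lift p.lift = 0 := p.2

theorem spans_lift (p : Boundary) : Spans p.lift p := ⟨1, one_ne_zero, (one_smul _ _).symm⟩

theorem spans_ofNull (v : Fin 3 → ℂ) (hv : v ≠ 0) (h : herm v v = 0) :
    Spans v (Boundary.ofNull v hv h) := by
  obtain ⟨a, ha⟩ := Projectivization.exists_smul_eq_mk_rep ℂ v hv
  exact ⟨a, a.ne_zero, ha.symm⟩

theorem Spans.eq {v : Fin 3 → ℂ} {p q : Boundary} (hp : Spans v p) (hq : Spans v q) : p = q := by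
  obtain ⟨c, hc, hp⟩ := hp
  obtain ⟨d, hd, hq⟩ := hq
  refine Subtype.ext ?_
  rw [← Projectivization.mk_rep p.1, ← Projectivization.mk_rep q.1,
    Projectivization.mk_eq_mk_iff']
  refine ⟨c / d, ?_⟩
  change (c / d) • q.lift = p.lift
  rw [hp, hq, smul_smul, div_mul_cancel₀ _ hd]

theorem Spans.of_smul {v : Fin 3 → ℂ} {p : Boundary} {c : ℂ} (hp : Spans (c • v) p) :
    Spans v p := by
  obtain ⟨d, hd, h⟩ := hp
  refine ⟨d * c, mul_ne_zero hd ?_, by rw [h, smul_smul]⟩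
  rintro rfl
  exact p.lift_ne_zero (by simp [h])

theorem Spans.exists_smul {v w : Fin 3 → ℂ} {p : Boundary} (hv : Spans v p) (hw : Spans w p) :
    ∃ c : ℂ, c ≠ 0 ∧ v = c • w := by
  obtain ⟨c, hc, hp⟩ := hv
  obtain ⟨d, hd, hq⟩ := hw
  refine ⟨c⁻¹ * d, by simp [hc, hd], ?_⟩
  rw [mul_smul, ← hq, hp, smul_smul, inv_mul_cancel₀ hc, one_smul]

theorem Spans.map {v : Fin 3 → ℂ} {p : Boundary} (hp : Spans v p) (A : SU21) :
    Spans (A.1.1 *ᵥ v) (A • p) := by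
  have h1 : Spans ((A : SpecialLinearGroup (Fin 3) ℂ) • p.lift) (A • p) := by
    have e : (A • p : Boundary).1 =
        Projectivization.mk ℂ ((A : SpecialLinearGroup (Fin 3) ℂ) • p.1.rep)
          ((smul_ne_zero_iff_ne _).mpr p.1.rep_nonzero) := by
      change (A : SpecialLinearGroup (Fin 3) ℂ) • p.1 = _
      conv_lhs => rw [← Projectivization.mk_rep p.1]
      rfl
    obtain ⟨a, ha⟩ := Projectivization.exists_smul_eq_mk_rep ℂ
      ((A : SpecialLinearGroup (Fin 3) ℂ) • p.1.rep) ((smul_ne_zero_iff_ne _).mpr p.1.rep_nonzero)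
    rw [← e] at ha
    exact ⟨a, a.ne_zero, ha.symm⟩
  obtain ⟨c, hc, h⟩ := hp
  rw [h, smul_comm] at h1
  exact h1.of_smul

theorem herm_mulVec (A : SU21) (v w : Fin 3 → ℂ) :
    herm (A.1.1 *ᵥ v) (A.1.1 *ᵥ w) = herm v w := A.2 v w

theorem crossRatio_of_spans {v₁ v₂ v₃ v₄ : Fin 3 → ℂ} {p₁ p₂ p₃ p₄ : Boundary}
    (h₁ : Spans v₁ p₁) (h₂ : Spans v₂ p₂) (h₃ : Spans v₃ p₃) (h₄ : Spans v₄ p₄) :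
    crossRatio p₁ p₂ p₃ p₄ = (herm v₃ v₁ * herm v₄ v₂) / (herm v₄ v₁ * herm v₃ v₂) := by
  obtain ⟨a, ha, h₁⟩ := h₁
  obtain ⟨b, hb, h₂⟩ := h₂
  obtain ⟨c, hc, h₃⟩ := h₃
  obtain ⟨d, hd, h₄⟩ := h₄
  have ha' : star a ≠ 0 := star_ne_zero.mpr ha
  have hb' : star b ≠ 0 := star_ne_zero.mpr hb
  simp only [crossRatio, h₁, h₂, h₃, h₄, herm_smul]
  rw [show c * star a * herm v₃ v₁ * (d * star b * herm v₄ v₂) =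
      (c * star a * d * star b) * (herm v₃ v₁ * herm v₄ v₂) by ring,
    show d * star a * herm v₄ v₁ * (c * star b * herm v₃ v₂) =
      (c * star a * d * star b) * (herm v₄ v₁ * herm v₃ v₂) by ring]
  exact mul_div_mul_left _ _ (by simp [ha, hb, hc, hd])

/-- Rescaling the lifts by `a`, `b`, `c` multiplies the triple product by the positive number
`|abc|²`. -/
theorem cartan_of_spans {v₁ v₂ v₃ : Fin 3 → ℂ} {p₁ p₂ p₃ : Boundary}
    (h₁ : Spans v₁ p₁) (h₂ : Spans v₂ p₂) (h₃ : Spans v₃ p₃) :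
    cartan p₁ p₂ p₃ = arg (-(herm v₁ v₂ * herm v₂ v₃ * herm v₃ v₁)) := by
  obtain ⟨a, ha, h₁⟩ := h₁
  obtain ⟨b, hb, h₂⟩ := h₂
  obtain ⟨c, hc, h₃⟩ := h₃
  simp only [cartan, h₁, h₂, h₃, herm_smul]
  have e : ∀ x : ℂ, x * star x = (‖x‖ : ℂ) ^ 2 := fun x => Complex.mul_conj' x
  rw [show -(a * star b * herm v₁ v₂ * (b * star c * herm v₂ v₃) * (c * star a * herm v₃ v₁)) =
    (((‖a‖ * ‖b‖ * ‖c‖) ^ 2 : ℝ) : ℂ) * -(herm v₁ v₂ * herm v₂ v₃ * herm v₃ v₁) by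
      push_cast; rw [mul_pow, mul_pow, ← e, ← e, ← e]; ring]
  exact arg_real_mul _ (by positivity)

theorem crossRatio_smul (A : SU21) (p₁ p₂ p₃ p₄ : Boundary) :
    crossRatio (A • p₁) (A • p₂) (A • p₃) (A • p₄) = crossRatio p₁ p₂ p₃ p₄ := by
  rw [crossRatio_of_spans ((spans_lift p₁).map A) ((spans_lift p₂).map A) ((spans_lift p₃).map A)
    ((spans_lift p₄).map A)]
  simp only [herm_mulVec, crossRatio]

/-! ### Heisenberg coordinates -/

/-- The first coordinate `-|z|² + i t` of the standard lift of `(z, t)`. -/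
noncomputable def heisHeight (z : ℂ) (t : ℝ) : ℂ := -(‖z‖ : ℂ) ^ 2 + t * I

/-- The standard lift of `(z, t)`. -/
noncomputable def heisVec (z : ℂ) (t : ℝ) : Fin 3 → ℂ :=
  ![heisHeight z t, (Real.sqrt 2 : ℂ) * z, 1]

theorem spans_heis (z : ℂ) (t : ℝ) : Spans (heisVec z t) (heis z t) := spans_ofNull _ _ _

theorem spans_infty : Spans ![1, 0, 0] infty := spans_ofNull _ _ _

theorem sqrt_two_mul_self : (Real.sqrt 2 : ℂ) * (Real.sqrt 2 : ℂ) = 2 := by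
  rw [← ofReal_mul, Real.mul_self_sqrt (by norm_num)]; norm_num

theorem sqrt_two_ne_zero : (Real.sqrt 2 : ℂ) ≠ 0 := fun h => by
  simpa [h] using sqrt_two_mul_self

theorem heis_ne_infty (z : ℂ) (t : ℝ) : heis z t ≠ infty := by
  intro h
  obtain ⟨c, hc, e⟩ := (h ▸ spans_heis z t).exists_smul spans_infty
  simpa [heisVec] using congrFun e 2

theorem heisHeight_re (z : ℂ) (t : ℝ) : (heisHeight z t).re = -‖z‖ ^ 2 := by
  simp [heisHeight, ← ofReal_pow]

theorem heisHeight_im (z : ℂ) (t : ℝ) : (heisHeight z t).im = t := by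
  simp [heisHeight, ← ofReal_pow]

theorem heis_injective {z z' : ℂ} {t t' : ℝ} (h : heis z t = heis z' t') : z = z' ∧ t = t' := by
  obtain ⟨c, hc, e⟩ := (h ▸ spans_heis z t).exists_smul (spans_heis z' t')
  have h2 := congrFun e 2
  simp [heisVec] at h2
  subst h2
  have h1 := congrFun e 1
  simp [heisVec] at h1
  have h0 := congrArg im (congrFun e 0)
  simp [heisVec, heisHeight_im] at h0
  exact ⟨h1, h0⟩

theorem zCoord_heis (z : ℂ) (t : ℝ) : zCoord (heis z t) = z := by
  obtain ⟨c, hc, h⟩ := spans_heis z t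
  have := sqrt_two_ne_zero
  simp [zCoord, h, heisVec]
  field_simp

theorem tCoord_heis (z : ℂ) (t : ℝ) : tCoord (heis z t) = t := by
  obtain ⟨c, hc, h⟩ := spans_heis z t
  simp [tCoord, h, heisVec]
  rw [mul_div_cancel_left₀ _ hc, heisHeight_im]

theorem eq_infty_or_heis (p : Boundary) : p = infty ∨ ∃ z t, p = heis z t := by
  have hn := p.herm_lift
  have hp := spans_lift p
  set v := p.lift with hv
  have hv0 : v ≠ 0 := p.lift_ne_zero
  simp only [herm] at hn
  by_cases h2 : v 2 = 0
  · left
    have h1 : v 1 = 0 := by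
      rw [h2] at hn
      simpa using hn
    refine Spans.eq (v := v) hp ?_
    have h0 : v = v 0 • ![1, 0, 0] := by
      ext i; fin_cases i <;> simp [h1, h2]
    have h00 : v 0 ≠ 0 := fun h => hv0 (by rw [h0, h, zero_smul])
    have := spans_infty
    rw [show (![1, 0, 0] : Fin 3 → ℂ) = (v 0)⁻¹ • v by
      conv_rhs => rw [h0]
      simp [h00]] at this
    exact this.of_smul
  · right
    refine ⟨v 1 / v 2 / (Real.sqrt 2 : ℂ), (v 0 / v 2).im, ?_⟩
    refine Spans.eq (v := v) hp ?_
    have := spans_heis (v 1 / v 2 / (Real.sqrt 2 : ℂ)) (v 0 / v 2).im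
    rw [show heisVec (v 1 / v 2 / (Real.sqrt 2 : ℂ)) (v 0 / v 2).im = (v 2)⁻¹ • v by
      -- Only the imaginary part of `v 0 / v 2` is free: nullity of `v` forces its real part to be
      -- `-|z|²`.
      have h2' : star (v 2) ≠ 0 := star_ne_zero.mpr h2
      have e : (v 0 / v 2).re = -‖v 1 / v 2 / (Real.sqrt 2 : ℂ)‖ ^ 2 := by
        have e1 : v 0 / v 2 + star (v 0 / v 2) + v 1 / v 2 * star (v 1 / v 2) = 0 := by
          rw [star_div₀, star_div₀]
          field_simp
          linear_combination hn
        have e2 : v 1 / v 2 * star (v 1 / v 2) = (‖v 1 / v 2‖ : ℂ) ^ 2 := Complex.mul_conj' _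
        rw [e2] at e1
        have e3 := congrArg re e1
        rw [← ofReal_pow] at e3
        simp only [add_re, Complex.star_def, conj_re, ofReal_re, zero_re] at e3
        rw [norm_div _ (Real.sqrt 2 : ℂ), div_pow, Complex.norm_real, Real.norm_eq_abs, sq_abs,
          Real.sq_sqrt (by norm_num)]
        linarith
      ext i
      fin_cases i
      · simp only [heisVec, Fin.zero_eta, cons_val_zero, Pi.smul_apply, smul_eq_mul]
        apply Complex.ext
        · rw [heisHeight_re, ← e, div_eq_inv_mul]
        · rw [heisHeight_im, div_eq_inv_mul]
      · have := sqrt_two_ne_zero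
        simp [heisVec]
        field_simp
      · simp [heisVec, h2]] at this
    exact this.of_smul

theorem herm_heisVec (z w : ℂ) (s t : ℝ) :
    herm (heisVec w s) (heisVec z t) =
      heisHeight w s + 2 * w * star z + star (heisHeight z t) := by
  simp [herm, heisVec]
  linear_combination (w * (starRingEnd ℂ) z) * sqrt_two_mul_self

/-! ### Special elements of `SU(2,1)` -/

/-- A matrix of determinant one that preserves the form, as an element of `SU(2,1)`. -/
def SU21.ofMatrix (M : Matrix (Fin 3) (Fin 3) ℂ) (hM : M.det = 1)
    (h : ∀ v w, herm (M *ᵥ v) (M *ᵥ w) = herm v w) : SU21 := ⟨⟨M, hM⟩, h⟩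

/-- The Heisenberg translation that maps `(0, 0)` to `(z, t)`. -/
noncomputable def heisTranslation (z : ℂ) (t : ℝ) : SU21 :=
  SU21.ofMatrix
    !![1, -((Real.sqrt 2 : ℂ) * star z), heisHeight z t; 0, 1, (Real.sqrt 2 : ℂ) * z; 0, 0, 1]
    (by simp [det_fin_three]) (by
    intro v w
    have hz : z * (starRingEnd ℂ) z = (‖z‖ : ℂ) ^ 2 := Complex.mul_conj' z
    simp [herm, mulVec, dotProduct, Fin.sum_univ_three, heisHeight]
    linear_combination (v 2 * (starRingEnd ℂ) (w 2) * z * (starRingEnd ℂ) z) * sqrt_two_mul_self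
      + (2 * v 2 * (starRingEnd ℂ) (w 2)) * hz)

/-- The element of `SU(2,1)` that interchanges `∞` and `(0, 0)`. -/
noncomputable def heisFlip : SU21 :=
  SU21.ofMatrix !![0, 0, -1; 0, -1, 0; -1, 0, 0] (by simp [det_fin_three]) (by
    intro v w
    simp [herm, mulVec, dotProduct, Fin.sum_univ_three]
    ring)

theorem heisTranslation_smul_zero (z : ℂ) (t : ℝ) : heisTranslation z t • heis 0 0 = heis z t := by
  refine ((spans_heis 0 0).map (heisTranslation z t)).eq ?_
  convert spans_heis z t using 1
  ext i
  fin_cases i <;>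
    simp [SU21.ofMatrix, heisTranslation, heisVec, heisHeight, mulVec, dotProduct, Fin.sum_univ_three]

theorem heisTranslation_smul_infty (z : ℂ) (t : ℝ) : heisTranslation z t • infty = infty := by
  refine (spans_infty.map (heisTranslation z t)).eq ?_
  convert spans_infty using 1
  ext i
  fin_cases i <;>
    simp [SU21.ofMatrix, heisTranslation, mulVec, dotProduct, Fin.sum_univ_three]

theorem heisFlip_smul_zero : heisFlip • heis 0 0 = infty := by
  refine Spans.eq (v := ![1, 0, 0]) (Spans.of_smul (c := -1) ?_) spans_infty
  convert (spans_heis 0 0).map heisFlip using 1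
  ext i
  fin_cases i <;>
    simp [SU21.ofMatrix, heisFlip, heisVec, heisHeight, mulVec, dotProduct, Fin.sum_univ_three]

theorem exists_smul_eq_infty (p : Boundary) : ∃ A : SU21, A • p = infty := by
  obtain rfl | ⟨z, t, rfl⟩ := eq_infty_or_heis p
  · exact ⟨1, one_smul _ _⟩
  · refine ⟨heisFlip * (heisTranslation z t)⁻¹, ?_⟩
    rw [mul_smul, inv_smul_eq_iff.mpr (heisTranslation_smul_zero z t).symm, heisFlip_smul_zero]

theorem exists_smul_eq_infty_zero {p q : Boundary} (h : p ≠ q) :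
    ∃ A : SU21, A • p = infty ∧ A • q = heis 0 0 := by
  obtain ⟨A, hA⟩ := exists_smul_eq_infty p
  obtain hq | ⟨z, t, hq⟩ := eq_infty_or_heis (A • q)
  · exact absurd (MulAction.injective A (hA.trans hq.symm)) h
  · refine ⟨(heisTranslation z t)⁻¹ * A, ?_, ?_⟩
    · rw [mul_smul, hA, inv_smul_eq_iff, heisTranslation_smul_infty]
    · rw [mul_smul, hq, inv_smul_eq_iff, heisTranslation_smul_zero]

/-! ### The stabiliser of `∞` and `(0, 0)` -/

/-- A number of unit modulus has an inverse cube root of unit modulus. -/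
theorem exists_cube_mul_eq_one {u : ℂ} (hu : ‖u‖ = 1) : ∃ m : ℂ, m ^ 3 * u = 1 ∧ ‖m‖ = 1 := by
  have hu0 : u ≠ 0 := by rintro rfl; simp at hu
  obtain ⟨m, hm⟩ := IsAlgClosed.exists_pow_nat_eq u⁻¹ (n := 3) (by norm_num)
  refine ⟨m, by rw [hm, inv_mul_cancel₀ hu0], ?_⟩
  have := congrArg norm hm
  rw [norm_pow, norm_inv, hu, inv_one] at this
  exact (pow_eq_one_iff_of_nonneg (norm_nonneg _) (by norm_num)).mp this

theorem mul_star_self_of_norm {u : ℂ} (hu : ‖u‖ = 1) : u * star u = 1 := by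
  have := Complex.mul_conj' u
  simpa [hu] using this

/-- The middle entry has the phase of `l` and the outer ones are real up to `m`; the cube root `m`
brings the determinant to one without changing the projective map. -/
theorem exists_stretch (l : ℂ) (hl : l ≠ 0) : ∃ (A : SU21) (m : ℂ), ‖m‖ = 1 ∧
    m ^ 3 * (l / ‖l‖) = 1 ∧
    A.1.1 = diagonal ![m * ‖l‖, m * (l / ‖l‖), m / ‖l‖] := by
  have hl0 : (‖l‖ : ℂ) ≠ 0 := by simpa using hl
  have hu : ‖l / (‖l‖ : ℂ)‖ = 1 := by simp [hl]
  obtain ⟨m, hm, hm1⟩ := exists_cube_mul_eq_one hu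
  refine ⟨SU21.ofMatrix (diagonal ![m * ‖l‖, m * (l / ‖l‖), m / ‖l‖]) ?_ ?_, m, hm1, hm, rfl⟩
  · rw [det_diagonal, Fin.prod_univ_three]
    simp only [cons_val]
    linear_combination hm + m ^ 3 * (l / ‖l‖) * mul_inv_cancel₀ hl0
  · intro v w
    have e1 : m * (starRingEnd ℂ) m = 1 := mul_star_self_of_norm hm1
    have e2 : l / (‖l‖ : ℂ) * ((starRingEnd ℂ) l / ‖l‖) = 1 := by
      have := mul_star_self_of_norm hu
      simpa using this
    simp [herm, mulVec_diagonal]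
    generalize l / (‖l‖ : ℂ) = u at *
    generalize (starRingEnd ℂ) l / (‖l‖ : ℂ) = u' at *
    rw [show m * ↑‖l‖ * v 0 * ((starRingEnd ℂ) m / ↑‖l‖ * (starRingEnd ℂ) (w 2)) =
      (m * (starRingEnd ℂ) m) * (v 0 * (starRingEnd ℂ) (w 2)) by field_simp,
      show m / ↑‖l‖ * v 2 * ((starRingEnd ℂ) m * ↑‖l‖ * (starRingEnd ℂ) (w 0)) =
      (m * (starRingEnd ℂ) m) * (v 2 * (starRingEnd ℂ) (w 0)) by field_simp, e1]
    linear_combination (v 1 * (starRingEnd ℂ) (w 1) * u * u') * e1 + (v 1 * (starRingEnd ℂ) (w 1)) * e2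

/-- `f` is the map `(z, t) ↦ (l z, |l|² t)`, `∞ ↦ ∞`. -/
def IsStretch (f : Boundary → Boundary) (l : ℂ) : Prop :=
  f infty = infty ∧ ∀ z t, f (heis z t) = heis (l * z) (‖l‖ ^ 2 * t)

theorem IsStretch.eq {f g : Boundary → Boundary} {l : ℂ} (hf : IsStretch f l)
    (hg : IsStretch g l) : f = g := by
  funext p
  obtain rfl | ⟨z, t, rfl⟩ := eq_infty_or_heis p
  · rw [hf.1, hg.1]
  · rw [hf.2, hg.2]

theorem IsStretch.comp {f g : Boundary → Boundary} {l m : ℂ} (hf : IsStretch f l)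
    (hg : IsStretch g m) : IsStretch (f ∘ g) (l * m) := by
  refine ⟨by simp [hg.1, hf.1], fun z t => ?_⟩
  rw [Function.comp_apply, hg.2, hf.2, norm_mul, mul_assoc, mul_pow, mul_assoc]

theorem IsStretch.inv {g : Equiv.Perm Boundary} {l : ℂ} (hl : l ≠ 0) (hg : IsStretch g l) :
    IsStretch (g⁻¹ : Equiv.Perm Boundary) l⁻¹ := by
  refine ⟨Equiv.Perm.inv_eq_iff_eq.mpr hg.1.symm, fun z t => ?_⟩
  rw [Equiv.Perm.inv_eq_iff_eq, hg.2, norm_inv]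
  have : ‖l‖ ≠ 0 := by simpa using hl
  congr 1 <;> field_simp

theorem isStretch_heisRotation (φ : ℝ) : IsStretch (heisRotation φ) (exp (φ * I)) := by
  refine ⟨by simp [heisRotation], fun z t => ?_⟩
  simp only [heisRotation, heis_ne_infty, if_false, zCoord_heis, tCoord_heis,
    norm_exp_ofReal_mul_I]
  rw [mul_comm]
  simp

theorem isStretch_heisDilation (r : ℝ) : IsStretch (heisDilation r) r := by
  refine ⟨by simp [heisDilation], fun z t => ?_⟩
  simp [heisDilation, heis_ne_infty, zCoord_heis, tCoord_heis]

/-- Preserving the form means `d₀ d̄₂ = 1` and `|d₁| = 1`, so the projective action depends on `d₁ /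
d₂` alone. -/
theorem isStretch_of_diagonal (A : SU21) (d : Fin 3 → ℂ) (h : A.1.1 = diagonal d) :
    IsStretch (A • ·) (d 1 / d 2) ∧ d 0 / d 2 = (‖d 1 / d 2‖ : ℂ) ^ 2 ∧ d 2 ≠ 0 := by
  have h02 : d 0 * (starRingEnd ℂ) (d 2) = 1 := by
    have := herm_mulVec A ![1, 0, 0] ![0, 0, 1]
    simpa [h, herm, mulVec_diagonal] using this
  have h11 : d 1 * (starRingEnd ℂ) (d 1) = 1 := by
    have := herm_mulVec A ![0, 1, 0] ![0, 1, 0]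
    simpa [h, herm, mulVec_diagonal] using this
  have h2 : d 2 ≠ 0 := by
    intro h
    simp [h] at h02
  have h2' : (starRingEnd ℂ) (d 2) ≠ 0 := by simpa using h2
  have hn : d 0 / d 2 = (‖d 1 / d 2‖ : ℂ) ^ 2 := by
    rw [← Complex.mul_conj', map_div₀]
    field_simp
    rw [h02, h11]
  refine ⟨⟨?_, fun z t => ?_⟩, hn, h2⟩
  · have := spans_infty.map A
    rw [show A.1.1 *ᵥ ![1, 0, 0] = d 0 • ![1, 0, 0] by
      rw [h]; ext i; fin_cases i <;> simp [mulVec_diagonal]] at this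
    exact this.of_smul.eq spans_infty
  · have := (spans_heis z t).map A
    rw [show A.1.1 *ᵥ heisVec z t = d 2 • heisVec (d 1 / d 2 * z) (‖d 1 / d 2‖ ^ 2 * t) by
      have e : heisHeight (d 1 / d 2 * z) (‖d 1 / d 2‖ ^ 2 * t) = d 0 / d 2 * heisHeight z t := by
        rw [hn]
        simp only [heisHeight, norm_mul]
        push_cast
        ring
      rw [h]; ext i; fin_cases i
      · simp only [Fin.zero_eta, mulVec_diagonal, heisVec, Pi.smul_apply, cons_val_zero,
          smul_eq_mul, e]
        field_simp
      · simp [mulVec_diagonal, heisVec]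
        field_simp
      · simp [mulVec_diagonal, heisVec]] at this
    exact this.of_smul.eq (spans_heis _ _)

/-- The fixed points make the outer basis vectors eigenvectors; the middle column is orthogonal to
both of them, hence a multiple of the middle basis vector. -/
theorem eq_diagonal_of_smul_eq (A : SU21) (h1 : A • infty = infty)
    (h2 : A • heis 0 0 = heis 0 0) : ∃ d, A.1.1 = diagonal d := by
  obtain ⟨c, hc, e1⟩ := (h1 ▸ spans_infty.map A).exists_smul spans_infty
  obtain ⟨d, hd, e2⟩ := (h2 ▸ (spans_heis 0 0).map A).exists_smul (spans_heis 0 0)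
  have a0 := congrFun e1 0
  have a1 := congrFun e1 1
  have a2 := congrFun e1 2
  have b0 := congrFun e2 0
  have b1 := congrFun e2 1
  have b2 := congrFun e2 2
  have f1 := herm_mulVec A ![0, 1, 0] ![1, 0, 0]
  have f2 := herm_mulVec A ![0, 1, 0] (heisVec 0 0)
  rw [e1] at f1
  rw [e2] at f2
  simp [mulVec, dotProduct, Fin.sum_univ_three, heisVec, heisHeight, herm, hc, hd] at *
  refine ⟨fun i => A.1.1 i i, ?_⟩
  ext i j
  fin_cases i <;> fin_cases j <;> simp [*]

theorem exists_smul_of_mem (g : PU21) :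
    ∃ A : SU21, ∀ x, (g : Equiv.Perm Boundary) x = A • x := by
  obtain ⟨A, hA⟩ := g.2
  exact ⟨A, fun x => by rw [← hA]; rfl⟩

/-- The transformation induced by an element of `SU(2,1)`. -/
noncomputable def toPU21 (A : SU21) : PU21 := (MulAction.toPermHom SU21 Boundary).rangeRestrict A

theorem toPU21_apply (A : SU21) (x : Boundary) :
    (toPU21 A : Equiv.Perm Boundary) x = A • x := rfl

theorem PU21_exists_isStretch (g : PU21) (h1 : (g : Equiv.Perm Boundary) infty = infty)
    (h2 : (g : Equiv.Perm Boundary) (heis 0 0) = heis 0 0) :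
    ∃ l : ℂ, l ≠ 0 ∧ IsStretch (g : Equiv.Perm Boundary) l := by
  obtain ⟨A, hA⟩ := exists_smul_of_mem g
  rw [hA] at h1 h2
  obtain ⟨d, hd⟩ := eq_diagonal_of_smul_eq A h1 h2
  obtain ⟨h, -, h2⟩ := isStretch_of_diagonal A d hd
  refine ⟨d 1 / d 2, ?_, ?_⟩
  · intro h0
    have h3 := h.2 1 0
    have h4 := h.2 0 0
    rw [h0, zero_mul] at h3 h4
    exact one_ne_zero (heis_injective (MulAction.injective A (h3.trans h4.symm))).1
  · rwa [show ((g : Equiv.Perm Boundary) : Boundary → Boundary) = (A • ·) from funext hA]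

theorem exists_isStretch (l : ℂ) (hl : l ≠ 0) :
    ∃ (A : SU21) (m : ℂ), IsStretch (A • ·) l ∧ ‖m‖ = 1 ∧ m ^ 3 * (l / ‖l‖) = 1 ∧
      A.1.1 = diagonal ![m * ‖l‖, m * (l / ‖l‖), m / ‖l‖] := by
  obtain ⟨A, m, h1, h2, h3⟩ := exists_stretch l hl
  refine ⟨A, m, ?_, h1, h2, h3⟩
  have hm : m ≠ 0 := by rintro rfl; simp at h1
  have hl0 : (‖l‖ : ℂ) ≠ 0 := by simpa using hl
  have := (isStretch_of_diagonal A _ h3).1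
  rwa [show (![m * (‖l‖ : ℂ), m * (l / ‖l‖), m / ‖l‖] 1 /
    ![m * (‖l‖ : ℂ), m * (l / ‖l‖), m / ‖l‖] 2) = l by simp; field_simp] at this

theorem PU21_exists_of_isStretch (l : ℂ) (hl : l ≠ 0) :
    ∃ g : PU21, IsStretch (g : Equiv.Perm Boundary) l := by
  obtain ⟨A, m, h, -⟩ := exists_isStretch l hl
  exact ⟨toPU21 A, h⟩

/-! ### Conjugacy of stretches. -/

theorem eq_smul_one_of_smul_eq (A : SU21) (h : ∀ x : Boundary, A • x = x) :
    ∃ c : ℂ, ‖c‖ = 1 ∧ c ^ 3 = 1 ∧ A.1.1 = c • (1 : Matrix (Fin 3) (Fin 3) ℂ) := by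
  obtain ⟨d, hd⟩ := eq_diagonal_of_smul_eq A (h _) (h _)
  obtain ⟨h1, h0, h2⟩ := isStretch_of_diagonal A d hd
  have h3 := (heis_injective ((h1.2 1 0).symm.trans (h _))).1
  rw [mul_one] at h3
  rw [h3] at h0
  rw [div_eq_iff h2] at h0 h3
  simp only [norm_one, ofReal_one, one_pow, one_mul] at h0 h3
  have e : A.1.1 = d 2 • (1 : Matrix (Fin 3) (Fin 3) ℂ) := by
    rw [hd, smul_one_eq_diagonal]
    congr 1
    ext i
    fin_cases i <;> simp [h0, h3]
  have hc : d 2 ^ 3 = 1 := by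
    have := A.1.2
    rw [e] at this
    simpa using this
  refine ⟨d 2, ?_, hc, e⟩
  have := congrArg norm hc
  rw [norm_pow, norm_one] at this
  exact (pow_eq_one_iff_of_nonneg (norm_nonneg _) (by norm_num)).mp this

/-- If `k ≠ 1`, dividing by `1 - k` leaves `S = k u (1 + k)`, whose modulus is below `2`. This is
the trace comparison of two conjugate stretches. -/
theorem eq_one_of_sub_mul_eq {S : ℝ} (hS : 2 ≤ S) {k u : ℂ} (hk : ‖k‖ = 1) (hu : ‖u‖ = 1)
    (h : (S : ℂ) + k ^ 3 * u = k * (S + u)) : k = 1 := by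
  by_contra hne
  have h1 : (S : ℂ) = k * u * (1 + k) := by
    apply mul_left_cancel₀ (sub_ne_zero.mpr (Ne.symm hne))
    linear_combination h
  have h2 : S = ‖1 + k‖ := by
    have := congrArg norm h1
    rwa [norm_mul, norm_mul, hk, hu, norm_real, Real.norm_of_nonneg (by linarith), one_mul,
      one_mul] at this
  have h3 : ‖1 + k‖ ^ 2 = 2 + 2 * k.re := by
    have hk2 : k.re * k.re + k.im * k.im = 1 := by
      rw [← normSq_apply, normSq_eq_norm_sq, hk]; norm_num
    rw [← normSq_eq_norm_sq, normSq_apply]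
    simp
    linarith
  have hre : 1 ≤ k.re := by nlinarith
  have him : k.im = 0 := by
    have hk2 : k.re * k.re + k.im * k.im = 1 := by
      rw [← normSq_apply, normSq_eq_norm_sq, hk]; norm_num
    nlinarith
  have hre' : k.re ≤ 1 := hk ▸ re_le_norm k
  exact hne (Complex.ext (by simp; linarith) (by simp [him]))

/-- Conjugacy of transformations lifts to matrices only up to a scalar in the kernel of the action,
a cube root of unity. -/
theorem IsConjugateTo.exists_matrix {g : PU21} {f : Boundary → Boundary} (h : IsConjugateTo g f)
    {G G' : SU21} (hG : (g : Equiv.Perm Boundary) = (G • · : Boundary → Boundary))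
    (hG' : f = (G' • ·)) :
    ∃ (A : SU21) (c : ℂ), ‖c‖ = 1 ∧ c ^ 3 = 1 ∧ A.1.1 * G.1.1 = c • (G'.1.1 * A.1.1) := by
  obtain ⟨h, hh⟩ := h
  obtain ⟨A, hA⟩ := exists_smul_of_mem h
  have hB : ∀ x : Boundary, (G'⁻¹ * (A * G * A⁻¹)) • x = x := by
    intro x
    rw [mul_smul, inv_smul_eq_iff]
    have h1 := hh x
    rw [hG'] at h1
    refine Eq.trans ?_ h1
    have hA' : ((h⁻¹ : PU21) : Equiv.Perm Boundary) x = A⁻¹ • x := by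
      rw [InvMemClass.coe_inv, Equiv.Perm.inv_eq_iff_eq, hA, smul_inv_smul]
    rw [Subgroup.coe_mul, Subgroup.coe_mul, Equiv.Perm.mul_apply, Equiv.Perm.mul_apply, hA', hA,
      hG, mul_smul, mul_smul]
  obtain ⟨c, h1, h2, h3⟩ := eq_smul_one_of_smul_eq _ hB
  refine ⟨A, c, h1, h2, ?_⟩
  have e : A * G = G' * (G'⁻¹ * (A * G * A⁻¹)) * A := by group
  have e' := congrArg (fun B : SU21 => B.1.1) e
  change A.1.1 * G.1.1 = G'.1.1 * (G'⁻¹ * (A * G * A⁻¹)).1.1 * A.1.1 at e'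
  rw [e', h3]
  simp

theorem IsConjugateTo.norm_eq_one {g : PU21} {f : Boundary → Boundary} (h : IsConjugateTo g f)
    {l l' : ℂ} (hl : l ≠ 0) (hg : IsStretch (g : Equiv.Perm Boundary) l) (hf : IsStretch f l')
    (hl' : ‖l'‖ = 1) : ‖l‖ = 1 := by
  have hl0' : l' ≠ 0 := by rintro rfl; simp at hl'
  obtain ⟨G, m, hG, hm, -, eG⟩ := exists_isStretch l hl
  obtain ⟨G', m', hG', hm', -, eG'⟩ := exists_isStretch l' hl0'
  obtain ⟨A, c, hc, -, e⟩ := h.exists_matrix (hg.eq hG) (hf.eq hG')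
  by_contra hne
  -- An entry of the first column satisfies `A i 0 * (m |l|) = c * (unit) * A i 0`, so it vanishes
  -- unless `|l| = 1`.
  have hA : A.1.1.det = 0 := by
    refine det_eq_zero_of_column_eq_zero 0 fun i => ?_
    have ei := congrFun (congrFun e i) 0
    rw [eG, eG', Matrix.smul_apply, mul_diagonal, diagonal_mul] at ei
    by_contra h0
    have en := congrArg norm ei
    have hd : ‖(![m' * (‖l'‖ : ℂ), m' * (l' / ‖l'‖), m' / ‖l'‖] : Fin 3 → ℂ) i‖ = 1 := by
      fin_cases i <;> simp [hm', hl']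
    rw [smul_eq_mul, norm_mul, norm_mul, norm_mul, hc, hd, one_mul, one_mul] at en
    have h0' : ‖A.1.1 i 0‖ ≠ 0 := norm_ne_zero_iff.mpr h0
    have : ‖(![m * (‖l‖ : ℂ), m * (l / ‖l‖), m / ‖l‖] : Fin 3 → ℂ) 0‖ = 1 :=
      mul_left_cancel₀ h0' (by rw [en, mul_one])
    simp [hm] at this
    exact hne this
  rw [A.1.2] at hA
  exact one_ne_zero hA

theorem IsConjugateTo.eq_of_norm_eq {g : PU21} {f : Boundary → Boundary} (h : IsConjugateTo g f)
    {l l' : ℂ} (hl : l ≠ 0) (hg : IsStretch (g : Equiv.Perm Boundary) l) (hf : IsStretch f l')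
    (hn : ‖l'‖ = ‖l‖) : l = l' := by
  have hl0' : l' ≠ 0 := norm_ne_zero_iff.mp (hn ▸ norm_ne_zero_iff.mpr hl)
  obtain ⟨G, m, hG, hm, hm3, eG⟩ := exists_isStretch l hl
  obtain ⟨G', m', hG', hm', hm3', eG'⟩ := exists_isStretch l' hl0'
  obtain ⟨A, c, hc, hc3, e⟩ := h.exists_matrix (hg.eq hG) (hf.eq hG')
  have hm0 : m ≠ 0 := by rintro rfl; simp at hm
  have hr : 0 < ‖l‖ := norm_pos_iff.mpr hl
  have hr0 : (‖l‖ : ℂ) ≠ 0 := by simpa using hl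
  -- The moduli agree, so both traces have the form `m (S + u)` with the same `S = |l| + 1 / |l| ≥
  -- 2`. The phases `u`, `u'` are tied to `m`, `m'` by the determinant, leaving one unknown `k = c
  -- m' / m`.
  have ht : G.1.1.trace = c * G'.1.1.trace := by
    have hi : A.1.1 * (A⁻¹).1.1 = 1 := congrArg (fun B : SU21 => B.1.1) (mul_inv_cancel A)
    have hi' : (A⁻¹).1.1 * A.1.1 = 1 := congrArg (fun B : SU21 => B.1.1) (inv_mul_cancel A)
    calc G.1.1.trace = ((A⁻¹).1.1 * (A.1.1 * G.1.1)).trace := by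
          rw [← Matrix.mul_assoc, hi', Matrix.one_mul]
      _ = c * G'.1.1.trace := by
          rw [trace_mul_comm, e, Matrix.smul_mul, Matrix.mul_assoc, hi, Matrix.mul_one, trace_smul,
            smul_eq_mul]
  rw [eG, eG', trace_diagonal, trace_diagonal, Fin.sum_univ_three, Fin.sum_univ_three] at ht
  simp only [cons_val] at ht
  rw [hn] at ht hm3'
  have hu' : ‖l' / (‖l‖ : ℂ)‖ = 1 := by
    rw [norm_div, hn, norm_real, norm_norm, div_self hr.ne']
  set u := l / (‖l‖ : ℂ) with hu
  set u' := l' / (‖l‖ : ℂ) with hu2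
  have hk3 : (c * m' / m) ^ 3 * u' = u := by
    rw [div_pow, mul_pow, hc3]
    field_simp
    linear_combination hm3' - hm3
  have hk : c * m' / m = 1 := by
    refine eq_one_of_sub_mul_eq (S := ‖l‖ + 1 / ‖l‖) (u := u') ?_ (by simp [hc, hm, hm']) hu' ?_
    · have : ‖l‖ + 1 / ‖l‖ - 2 = (‖l‖ - 1) ^ 2 / ‖l‖ := by field_simp; ring
      have : 0 ≤ (‖l‖ - 1) ^ 2 / ‖l‖ := by positivity
      linarith
    · rw [hk3]
      push_cast
      field_simp
      field_simp at ht
      linear_combination ht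
  rw [hk, one_pow, one_mul, hu, hu2, div_left_inj' hr0] at hk3
  exact hk3.symm

theorem IsConjugateTo.of_isStretch {g : PU21} {f : Boundary → Boundary} {l : ℂ}
    (hg : IsStretch (g : Equiv.Perm Boundary) l) (hf : IsStretch f l) : IsConjugateTo g f :=
  ⟨1, fun x => by rw [one_mul, inv_one, mul_one, hg.eq hf]⟩

/-! ### Quadruples with `p₂ = ∞` and `p₃ = (0, 0)` -/

/-- The Hermitian product of the standard lifts of `(w, s)` and `(z, t)`. -/
noncomputable def heisProd (z : ℂ) (t : ℝ) (w : ℂ) (s : ℝ) : ℂ :=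
  heisHeight w s + 2 * w * conj z + conj (heisHeight z t)

/-- The quadruple `((z, t), ∞, (0, 0), (w, s))`. -/
def IsStandard (p : Fin 4 → Boundary) (z : ℂ) (t : ℝ) (w : ℂ) (s : ℝ) : Prop :=
  p 0 = heis z t ∧ p 1 = infty ∧ p 2 = heis 0 0 ∧ p 3 = heis w s

theorem heisHeight_zero : heisHeight 0 0 = 0 := by simp [heisHeight]

theorem heisHeight_mul (l z : ℂ) (t : ℝ) :
    heisHeight (l * z) (‖l‖ ^ 2 * t) = (‖l‖ : ℂ) ^ 2 * heisHeight z t := by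
  simp only [heisHeight, norm_mul]
  push_cast
  ring

theorem heisHeight_eq_zero {z : ℂ} {t : ℝ} (h : heisHeight z t = 0) : z = 0 ∧ t = 0 := by
  have h1 := heisHeight_re z t
  have h2 := heisHeight_im z t
  rw [h] at h1 h2
  simp at h1 h2
  exact ⟨h1, h2.symm⟩

/-- A stretch changes the product by a positive factor only, so its phase survives while `z` is
rotated. -/
theorem heisProd_mul (l z w : ℂ) (s t : ℝ) :
    heisProd (l * z) (‖l‖ ^ 2 * t) (l * w) (‖l‖ ^ 2 * s) = (‖l‖ : ℂ) ^ 2 * heisProd z t w s := by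
  simp only [heisProd, heisHeight_mul, map_mul, map_pow, conj_ofReal]
  rw [← Complex.mul_conj']
  ring

/-- The real part of the product is `-|z - w|²`; once `z = w`, the imaginary part is `s - t`. -/
theorem heisProd_eq_zero {z w : ℂ} {s t : ℝ} (h : heisProd z t w s = 0) : z = w ∧ t = s := by
  have hr := congrArg re h
  have hi := congrArg im h
  have n1 := Complex.sq_norm z
  have n2 := Complex.sq_norm w
  rw [normSq_apply] at n1 n2
  simp [heisProd, heisHeight_re, heisHeight_im] at hr hi
  have h1 : (z.re - w.re) ^ 2 + (z.im - w.im) ^ 2 = 0 := by linarith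
  have e1 : z.re = w.re := by nlinarith [sq_nonneg (z.re - w.re), sq_nonneg (z.im - w.im)]
  have e2 : z.im = w.im := by nlinarith [sq_nonneg (z.re - w.re), sq_nonneg (z.im - w.im)]
  refine ⟨Complex.ext e1 e2, ?_⟩
  rw [e1, e2] at hi
  linarith

theorem herm_heisVec_infty (z : ℂ) (t : ℝ) : herm (heisVec z t) ![1, 0, 0] = 1 := by
  simp [herm, heisVec]

theorem herm_infty_heisVec (z : ℂ) (t : ℝ) : herm ![1, 0, 0] (heisVec z t) = 1 := by
  simp [herm, heisVec]

theorem herm_heisVec_zero (z : ℂ) (t : ℝ) :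
    herm (heisVec z t) (heisVec 0 0) = heisHeight z t := by
  simp [herm_heisVec, heisHeight_zero]

theorem herm_zero_heisVec (z : ℂ) (t : ℝ) :
    herm (heisVec 0 0) (heisVec z t) = conj (heisHeight z t) := by
  simp [herm_heisVec, heisHeight_zero]

section Standard

variable {p : Fin 4 → Boundary} {z w : ℂ} {t s : ℝ}

theorem IsStandard.spans (h : IsStandard p z t w s) : Spans (heisVec z t) (p 0) ∧
    Spans ![1, 0, 0] (p 1) ∧ Spans (heisVec 0 0) (p 2) ∧ Spans (heisVec w s) (p 3) := by
  rw [h.1, h.2.1, h.2.2.1, h.2.2.2]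
  exact ⟨spans_heis _ _, spans_infty, spans_heis _ _, spans_heis _ _⟩

theorem IsStandard.X₁_eq (h : IsStandard p z t w s) :
    X₁ p = conj (heisHeight z t) / heisProd z t w s := by
  obtain ⟨h0, h1, h2, h3⟩ := h.spans
  rw [X₁, crossRatio_of_spans h0 h1 h2 h3, herm_zero_heisVec, herm_heisVec_infty,
    herm_heisVec_infty, herm_heisVec, mul_one, mul_one]
  rfl

theorem IsStandard.X₂_eq (h : IsStandard p z t w s) :
    X₂ p = heisHeight w s / heisProd z t w s := by
  obtain ⟨h0, h1, h2, h3⟩ := h.spans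
  rw [X₂, crossRatio_of_spans h0 h2 h1 h3, herm_infty_heisVec, herm_infty_heisVec,
    herm_heisVec_zero, herm_heisVec, mul_one, one_mul]
  rfl

theorem IsStandard.X₃_eq (h : IsStandard p z t w s) :
    X₃ p = heisHeight w s / heisHeight z t := by
  obtain ⟨h0, h1, h2, h3⟩ := h.spans
  rw [X₃, crossRatio_of_spans h1 h2 h0 h3, herm_heisVec_infty, herm_heisVec_infty,
    herm_heisVec_zero, herm_heisVec_zero, one_mul, one_mul]

theorem IsStandard.A₁_eq (h : IsStandard p z t w s) : A₁ p = arg (-conj (heisHeight w s)) := by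
  obtain ⟨h0, h1, h2, h3⟩ := h.spans
  rw [A₁, cartan_of_spans h1 h2 h3, herm_infty_heisVec, herm_heisVec_infty, herm_zero_heisVec,
    one_mul, mul_one]

theorem IsStandard.A₃_eq (h : IsStandard p z t w s) : A₃ p = arg (-heisProd z t w s) := by
  obtain ⟨h0, h1, h2, h3⟩ := h.spans
  rw [A₃, cartan_of_spans h0 h1 h3, herm_infty_heisVec, herm_heisVec_infty, herm_heisVec,
    one_mul, one_mul]
  rfl

theorem IsStandard.A₄_eq (h : IsStandard p z t w s) : A₄ p = arg (-conj (heisHeight z t)) := by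
  obtain ⟨h0, h1, h2, h3⟩ := h.spans
  rw [A₄, cartan_of_spans h0 h1 h2, herm_infty_heisVec, herm_heisVec_infty, herm_zero_heisVec,
    one_mul, one_mul]

theorem IsStandard.height_ne_zero (h : IsStandard p z t w s) (hp : Function.Injective p) :
    heisHeight z t ≠ 0 ∧ heisHeight w s ≠ 0 ∧ heisProd z t w s ≠ 0 := by
  obtain ⟨h0, h1, h2, h3⟩ := h
  refine ⟨fun e => ?_, fun e => ?_, fun e => ?_⟩
  · obtain ⟨rfl, rfl⟩ := heisHeight_eq_zero e
    exact absurd (hp (h0.trans h2.symm)) (by decide)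
  · obtain ⟨rfl, rfl⟩ := heisHeight_eq_zero e
    exact absurd (hp (h3.trans h2.symm)) (by decide)
  · obtain ⟨rfl, rfl⟩ := heisProd_eq_zero e
    exact absurd (hp (h0.trans h3.symm)) (by decide)

theorem IsStandard.one_sub (h : IsStandard p z t w s) (hp : Function.Injective p) :
    1 - X₁ p - X₂ p = 2 * w * conj z / heisProd z t w s := by
  obtain ⟨-, -, h0⟩ := h.height_ne_zero hp
  rw [h.X₁_eq, h.X₂_eq]
  field_simp
  rw [heisProd]
  ring

end Standard

/-! ### The normal form as a modulus condition and a phase condition. -/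

/-- Polar coordinates of the height of `(z, t)`. -/
theorem norm_mul_cos_arg_height (z : ℂ) (t : ℝ) :
    ‖heisHeight z t‖ * Real.cos (arg (-conj (heisHeight z t))) = ‖z‖ ^ 2 ∧
    ‖heisHeight z t‖ * Real.sin (arg (-conj (heisHeight z t))) = t := by
  have h1 := norm_mul_cos_arg (-conj (heisHeight z t))
  have h2 := norm_mul_sin_arg (-conj (heisHeight z t))
  rw [norm_neg, norm_conj] at h1 h2
  rw [h1, h2]
  simp [heisHeight_re, heisHeight_im]

theorem neg_eq_norm_mul_exp (x : ℂ) : -x = ‖x‖ * exp (arg (-x) * I) := by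
  have := norm_mul_exp_arg_mul_I (-x)
  rw [norm_neg] at this
  exact this.symm

theorem IsStandard.isNormalised {p : Fin 4 → Boundary} {z w : ℂ} {t s : ℝ}
    (h : IsStandard p z t w s) (hp : Function.Injective p) (h1 : ‖heisHeight z t‖ = 1)
    (h2 : z * ‖heisProd z t w s‖ = -(‖z‖ * conj (heisProd z t w s))) : IsNormalised p := by
  obtain ⟨-, -, hP⟩ := h.height_ne_zero hp
  have hP' : (‖heisProd z t w s‖ : ℂ) ≠ 0 := by simpa using hP
  obtain ⟨c4, s4⟩ := norm_mul_cos_arg_height z t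
  obtain ⟨c1, s1⟩ := norm_mul_cos_arg_height w s
  rw [← h.A₄_eq, h1, one_mul] at c4 s4
  rw [← h.A₁_eq] at c1 s1
  have hX : ‖X₃ p‖ = ‖heisHeight w s‖ := by rw [h.X₃_eq, norm_div, h1, div_one]
  have hne : ‖heisHeight w s‖ ≠ 0 := norm_ne_zero_iff.mpr (h.height_ne_zero hp).2.1
  have e3 := neg_eq_norm_mul_exp (heisProd z t w s)
  rw [← h.A₃_eq] at e3
  have e3' := congrArg conj e3
  rw [map_neg, map_mul, conj_ofReal, ← exp_conj, map_mul, conj_ofReal, conj_I] at e3'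
  -- The phase condition makes `z̄ / H` a nonpositive real, so `1 - X₁ - X₂ = 2 w z̄ / H` is a
  -- nonnegative multiple of `-w`.
  refine ⟨h.2.1, h.2.2.1, ?_, arg (-w), ?_, ?_⟩
  · rw [h.1, s4, c4, Real.sqrt_sq (norm_nonneg _)]
    congr 1
    apply mul_right_cancel₀ hP'
    rw [h2, ← mul_neg, e3', mul_assoc, mul_comm (exp _)]
    congr 3
    ring_nf
  · rw [IsArgument, h.one_sub hp]
    have hz := congrArg conj h2
    simp only [map_mul, map_neg, conj_ofReal, conj_conj] at hz
    have e : 2 * w * conj z / heisProd z t w s =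
        ((2 * ‖z‖ / ‖heisProd z t w s‖ : ℝ) : ℂ) * -w := by
      push_cast
      field_simp
      linear_combination w * hz
    rw [e, norm_mul, norm_neg, norm_real, Real.norm_of_nonneg (by positivity), ofReal_mul,
      mul_assoc, ← neg_eq_norm_mul_exp]
  · rw [h.2.2.2, hX, s1]
    congr 1
    rw [← ofReal_mul, mul_comm √(Real.cos _), ← Real.sqrt_mul (norm_nonneg _), c1,
      Real.sqrt_sq (norm_nonneg _), ← neg_eq_norm_mul_exp, neg_neg]

theorem IsNormalised.exists_isStandard {p : Fin 4 → Boundary} (h : IsNormalised p)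
    (hp : Function.Injective p) : ∃ z t w s, IsStandard p z t w s ∧ ‖heisHeight z t‖ = 1 ∧
      z * ‖heisProd z t w s‖ = -(‖z‖ * conj (heisProd z t w s)) := by
  obtain ⟨h1, h2, h0, β, -, h3⟩ := h
  obtain ⟨w, s, h3⟩ : ∃ w s, p 3 = heis w s := ⟨_, _, h3⟩
  set z := (Real.sqrt (Real.cos (A₄ p)) : ℂ) * exp (-(A₃ p) * I) with hz
  set t := Real.sin (A₄ p) with ht
  refine ⟨z, t, w, s, ⟨h0, h1, h2, h3⟩, ?_, ?_⟩
  all_goals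
    have h : IsStandard p z t w s := ⟨h0, h1, h2, h3⟩
    have hzn : ‖z‖ = √(Real.cos (A₄ p)) := by
      rw [hz, norm_mul, norm_real, Real.norm_of_nonneg (Real.sqrt_nonneg _), ← ofReal_neg,
        norm_exp_ofReal_mul_I, mul_one]
  · obtain ⟨c4, s4⟩ := norm_mul_cos_arg_height z t
    rw [← h.A₄_eq] at c4 s4
    have hpos := norm_pos_iff.mpr (h.height_ne_zero hp).1
    have hc : 0 ≤ Real.cos (A₄ p) := by
      by_contra hneg
      have := mul_neg_of_pos_of_neg hpos (not_le.mp hneg)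
      rw [c4] at this
      exact absurd this (not_lt.mpr (sq_nonneg _))
    rw [hzn, Real.sq_sqrt hc] at c4
    have := Real.sin_sq_add_cos_sq (A₄ p)
    rw [← ht] at this s4
    -- Here `|z|² = cos A₄` and `t = sin A₄`, so the height has the polar coordinates of a point of
    -- the unit circle.
    have e : (‖heisHeight z t‖ - 1) * (t ^ 2 + Real.cos (A₄ p) ^ 2) = 0 := by
      linear_combination Real.cos (A₄ p) * c4 + t * s4
    rw [this, mul_one] at e
    linarith
  · have e3 := neg_eq_norm_mul_exp (heisProd z t w s)
    rw [← h.A₃_eq] at e3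
    have e3' := congrArg conj e3
    rw [map_neg, map_mul, conj_ofReal, ← exp_conj, map_mul, conj_ofReal, conj_I] at e3'
    rw [← mul_neg, e3', hzn]
    conv_lhs => rw [hz]
    rw [mul_assoc, mul_comm (exp _)]
    congr 3
    ring_nf

theorem SameConfiguration.injective {p q : Fin 4 → Boundary} (h : SameConfiguration p q)
    (hp : Function.Injective p) : Function.Injective q := by
  obtain ⟨g, hg⟩ := h
  intro i j hij
  rw [← hg, ← hg] at hij
  exact hp (Equiv.injective _ hij)

theorem SameConfiguration.X_eq {p q : Fin 4 → Boundary} (h : SameConfiguration p q) :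
    X₁ q = X₁ p ∧ X₂ q = X₂ p ∧ X₃ q = X₃ p := by
  obtain ⟨g, hg⟩ := h
  obtain ⟨A, hA⟩ := exists_smul_of_mem g
  simp only [X₁, X₂, X₃, ← hg, hA, crossRatio_smul, and_self]

theorem exists_norm_mul_eq (z v : ℂ) (hv : ‖v‖ = 1) : ∃ u : ℂ, ‖u‖ = 1 ∧ u * z = ‖z‖ * v := by
  by_cases hz : z = 0
  · exact ⟨1, by simp, by simp [hz]⟩
  · exact ⟨‖z‖ * v / z, by simp [hv, hz], by field_simp⟩

theorem exists_isNormalised {p : Fin 4 → Boundary} (hp : Function.Injective p) :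
    ∃ q, SameConfiguration p q ∧ IsNormalised q := by
  obtain ⟨A, hA1, hA2⟩ := exists_smul_eq_infty_zero (hp.ne (by decide : (1 : Fin 4) ≠ 2))
  have hfin : ∀ i : Fin 4, i ≠ 1 → ∃ z t, A • p i = heis z t := fun i hi =>
    (eq_infty_or_heis _).resolve_left fun h => hi (hp (MulAction.injective A (h.trans hA1.symm)))
  obtain ⟨z, t, h0⟩ := hfin 0 (by decide)
  obtain ⟨w, s, h3⟩ := hfin 3 (by decide)
  have hst : IsStandard (fun i => A • p i) z t w s := ⟨h0, hA1, hA2, h3⟩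
  obtain ⟨hz, -, hP⟩ := hst.height_ne_zero fun i j hij => hp (MulAction.injective A hij)
  have hPn : (‖heisProd z t w s‖ : ℂ) ≠ 0 := by simpa using hP
  -- The normalising stretch is `r u`: `u` turns `z` to the phase of `-H̄`, and `r² = 1 / |a₁|`
  -- makes the height of `p₁` unimodular.
  obtain ⟨u, hu, huz⟩ := exists_norm_mul_eq z (-(conj (heisProd z t w s) / ‖heisProd z t w s‖))
    (by simp [hP])
  set r : ℝ := (√‖heisHeight z t‖)⁻¹ with hr
  have hr0 : 0 < r := inv_pos.mpr (Real.sqrt_pos.mpr (norm_pos_iff.mpr hz))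
  have hln : ‖(r : ℂ) * u‖ = r := by
    rw [norm_mul, hu, mul_one, norm_real, Real.norm_of_nonneg hr0.le]
  obtain ⟨B, m, hB, -⟩ := exists_isStretch (r * u) (norm_ne_zero_iff.mp (by rw [hln]; exact hr0.ne'))
  have hq : SameConfiguration p fun i => (B * A) • p i :=
    ⟨toPU21 (B * A), fun i => toPU21_apply _ _⟩
  refine ⟨_, hq, ?_⟩
  have hst' : IsStandard (fun i => (B * A) • p i) (r * u * z) (‖(r : ℂ) * u‖ ^ 2 * t)
      (r * u * w) (‖(r : ℂ) * u‖ ^ 2 * s) := by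
    have hB0 := hB.2 0 0
    rw [mul_zero, mul_zero] at hB0
    simp only [IsStandard, mul_smul, h0, hA1, hA2, h3]
    exact ⟨hB.2 _ _, hB.1, hB0, hB.2 _ _⟩
  refine hst'.isNormalised (hq.injective hp) ?_ ?_
  · rw [heisHeight_mul, hln, norm_mul, norm_pow, norm_real, Real.norm_of_nonneg hr0.le, hr,
      inv_pow, Real.sq_sqrt (norm_nonneg _), inv_mul_cancel₀ (norm_ne_zero_iff.mpr hz)]
  · rw [heisProd_mul, hln, norm_mul, norm_pow, norm_real, Real.norm_of_nonneg hr0.le,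
      norm_mul, hln, map_mul, map_pow, conj_ofReal, mul_assoc (r : ℂ) u, huz]
    push_cast
    field_simp

/-! ### Algebra of the invariants -/

theorem mul_conj_of_norm_eq {a : ℂ} {R : ℝ} (h : ‖a‖ = R) : a * conj a = (R : ℂ) ^ 2 := by
  rw [Complex.mul_conj', h]

/-- The double of an argument of `(1 - X₁ - X₂) / (X₁^{1/2} X₂^{1/2})`. -/
theorem exp_two_mul_of_isArgument {a₁ a₄ y H : ℂ} {R φ : ℝ} (h₁ : ‖a₁‖ = 1) (h₄ : ‖a₄‖ = R)
    (hR : 0 < R) (hH : H ≠ 0)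
    (h : IsArgument φ (2 * y / H / ((conj a₁ / H) ^ (1 / 2 : ℂ) * (a₄ / H) ^ (1 / 2 : ℂ)))) :
    exp ((2 * φ : ℝ) * I) * conj y * (conj a₁ * a₄) = y * R := by
  have ha₁ : conj a₁ ≠ 0 := by
    rw [← norm_ne_zero_iff, norm_conj, h₁]; exact one_ne_zero
  have ha₄ : a₄ ≠ 0 := by rw [← norm_ne_zero_iff, h₄]; exact hR.ne'
  have hR0 : (R : ℂ) ≠ 0 := ofReal_ne_zero.mpr hR.ne'
  have hsq : ∀ x : ℂ, (x ^ (1 / 2 : ℂ)) ^ 2 = x := fun x => by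
    rw [one_div]; exact cpow_nat_inv_pow x two_ne_zero
  set v := 2 * y / H / ((conj a₁ / H) ^ (1 / 2 : ℂ) * (a₄ / H) ^ (1 / 2 : ℂ)) with hv
  -- Squaring removes both the choice of square roots and the factor `H`; this is why the angle `2φ`
  -- appears.
  have hv2 : v ^ 2 = 4 * y ^ 2 / (conj a₁ * a₄) := by
    rw [hv, div_pow, mul_pow, hsq, hsq]
    field_simp
    ring
  clear_value v
  have hn : (‖v‖ : ℂ) ^ 2 = 4 * (y * conj y) / R := by
    have := congrArg norm hv2
    rw [norm_pow, norm_div, norm_mul, norm_mul, norm_conj, h₁, h₄, norm_pow, one_mul] at this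
    rw [← ofReal_pow, this, Complex.mul_conj']
    push_cast
    simp
  have he : v ^ 2 = (‖v‖ : ℂ) ^ 2 * exp ((2 * φ : ℝ) * I) := by
    conv_lhs => rw [h]
    rw [mul_pow, ← Complex.exp_nat_mul]
    congr 2
    push_cast
    ring
  rw [hv2, hn] at he
  by_cases hy : y = 0
  · simp [hy]
  field_simp at he
  linear_combination -he

/-- The first factor is the product `H'` of the paired quadruple, with `y = w z̄` and `e = l₁ l̄₄`.
The hypothesis on `e` matches the middle terms; the outer ones match because `|a₁| = 1` and `|a₄| =
R`. -/
theorem heisProd_transform {a₁ a₄ y e : ℂ} {R : ℝ} (h₁ : ‖a₁‖ = 1) (h₄ : ‖a₄‖ = R)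
    (hR : 0 < R) (he : e * conj y * (conj a₁ * a₄) = y * R) :
    (R * a₁ + 2 * (e * conj y) + conj a₄ / R) * (conj a₁ * a₄) = R * (a₄ + 2 * y + conj a₁) := by
  have e₁ := mul_conj_of_norm_eq h₁
  have e₄ := mul_conj_of_norm_eq h₄
  have hR0 : (R : ℂ) ≠ 0 := ofReal_ne_zero.mpr hR.ne'
  field_simp
  push_cast at e₁
  linear_combination R ^ 2 * a₄ * e₁ + conj a₁ * e₄ + 2 * R * he

/-- If the cross-ratios are related by `𝒯`, the heights are interchanged up to scale. -/
theorem height_eq_of_involution {a₁ a₄ b₁ b₄ H H' : ℂ} {R : ℝ} (h₁ : ‖a₁‖ = 1) (h₄ : ‖a₄‖ = R)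
    (hb : ‖b₁‖ = 1) (hR : 0 < R) (hH : H ≠ 0) (hH' : H' ≠ 0)
    (ra₁ : a₁.re ≤ 0) (ra₄ : a₄.re ≤ 0) (rb₁ : b₁.re ≤ 0) (rb₄ : b₄.re ≤ 0)
    (hX : (a₄ / a₁).im ≠ 0) (hX₁ : conj a₁ / H = conj b₁ / H') (hX₂ : a₄ / H = b₄ / H')
    (hX₃ : conj (a₄ / a₁) = b₄ / b₁) : b₁ * R = a₄ ∧ b₄ = R * a₁ := by
  have e₁ : a₁ * conj a₁ = 1 := by simpa using mul_conj_of_norm_eq h₁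
  have f₁ : b₁ * conj b₁ = 1 := by simpa using mul_conj_of_norm_eq hb
  have e₄ := mul_conj_of_norm_eq h₄
  have ha₁ : a₁ ≠ 0 := left_ne_zero_of_mul_eq_one e₁
  have ha₁' : conj a₁ ≠ 0 := right_ne_zero_of_mul_eq_one e₁
  have hb₁ : b₁ ≠ 0 := left_ne_zero_of_mul_eq_one f₁
  have hR0 : (R : ℂ) ≠ 0 := ofReal_ne_zero.mpr hR.ne'
  rw [div_eq_div_iff hH hH'] at hX₁ hX₂
  rw [map_div₀, div_eq_div_iff ha₁' hb₁] at hX₃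
  have g₁ : b₄ * conj a₁ = conj b₁ * a₄ := by
    apply mul_right_cancel₀ (mul_ne_zero hH hH')
    linear_combination b₄ * H * hX₁ - conj b₁ * H * hX₂
  have g₂ : b₁ * conj a₄ = conj b₁ * a₄ := by linear_combination hX₃ + g₁
  -- By `g₂` the number `b₁ ā₄` is real, and `|b₁| R = |a₄|`; hence the sign ambiguity.
  have g₃ : (b₁ * R - a₄) * (b₁ * R + a₄) = 0 := by
    linear_combination a₄ * b₁ * g₂ + a₄ ^ 2 * f₁ - b₁ ^ 2 * e₄
  have g₄ : b₄ = conj b₁ * a₄ * a₁ := by linear_combination a₁ * g₁ - b₄ * e₁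
  rcases mul_eq_zero.mp g₃ with g | g
  · have g' : b₁ * R = a₄ := by linear_combination g
    refine ⟨g', ?_⟩
    rw [g₄, ← g']
    linear_combination a₁ * R * f₁
  · exfalso
    have g' : a₄ = -(b₁ * R) := by linear_combination g
    have k₄ : b₄ = -(R * a₁) := by
      rw [g₄, g']
      linear_combination -a₁ * R * f₁
    have r₄ : a₄.re = -(b₁.re * R) := by rw [g']; simp
    have s₄ : b₄.re = -(R * a₁.re) := by rw [k₄]; simp
    have z₁ : a₁.re = 0 := by nlinarith
    have z₄ : a₄.re = 0 := by nlinarith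
    apply hX
    rw [div_im, z₁, z₄]
    simp

/-- Here `z₁`, `z₄` and `w₁`, `w₄` are the horizontal coordinates of `p₁`, `p₄` in the two
quadruples. When nonzero they force `l₁ = w₄ / z₁` and `l₄ = w₁ / z₄`, and the phase conditions give
the phase of `l₁ l₄`. If `z₁` or `z₄` vanishes, one factor is free in phase and is chosen to give
that product. -/
theorem exists_stretch_factors {a₁ a₄ b₁ b₄ z₁ z₄ w₁ w₄ H H' : ℂ} {R : ℝ} (h₁ : ‖a₁‖ = 1)
    (h₄ : ‖a₄‖ = R) (hR : 0 < R) (hH : H ≠ 0) (hH' : H' ≠ 0)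
    (ra₁ : a₁.re = -‖z₁‖ ^ 2) (ra₄ : a₄.re = -‖z₄‖ ^ 2) (rb₁ : b₁.re = -‖w₁‖ ^ 2)
    (rb₄ : b₄.re = -‖w₄‖ ^ 2) (hX : (a₄ / a₁).im ≠ 0) (hb₁ : b₁ * R = a₄) (hb₄ : b₄ = R * a₁)
    (hX₁ : conj a₁ / H = conj b₁ / H') (hY : z₄ * conj z₁ / H = w₄ * conj w₁ / H')
    (hz : z₁ * ‖H‖ = -(‖z₁‖ * conj H)) (hw : w₁ * ‖H'‖ = -(‖w₁‖ * conj H')) :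
    ∃ l₁ l₄ : ℂ, ‖l₁‖ ^ 2 = R ∧ ‖l₄‖ ^ 2 * R = 1 ∧ l₁ * z₁ = w₄ ∧ l₄ * z₄ = w₁ ∧
      l₁ * l₄ * (R * a₁) = a₄ ∧ (z₄ * conj z₁ = 0 ∨
        ∀ e : ℂ, e * conj (z₄ * conj z₁) * (conj a₁ * a₄) = z₄ * conj z₁ * R → l₁ = e * R * l₄) := by
  have hR0 : (R : ℂ) ≠ 0 := ofReal_ne_zero.mpr hR.ne'
  have e₁ : a₁ * conj a₁ = 1 := by simpa using mul_conj_of_norm_eq h₁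
  have e₄ := mul_conj_of_norm_eq h₄
  have ha₁ : a₁ ≠ 0 := left_ne_zero_of_mul_eq_one e₁
  have ha₁' : conj a₁ ≠ 0 := right_ne_zero_of_mul_eq_one e₁
  have ha₄ : a₄ ≠ 0 := by rw [← norm_ne_zero_iff, h₄]; exact hR.ne'
  have n₁ : ‖w₁‖ ^ 2 * R = ‖z₄‖ ^ 2 := by
    have := congrArg re hb₁
    simp [rb₁, ra₄] at this
    linarith
  have n₄ : ‖w₄‖ ^ 2 = R * ‖z₁‖ ^ 2 := by
    have := congrArg re hb₄
    simp [rb₄, ra₁] at this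
    linarith
  have hprod : ∀ {l l' : ℂ}, l * l' * (R * a₁) = a₄ → ‖l‖ * ‖l'‖ = 1 := by
    intro l l' h
    have := congrArg norm h
    rw [norm_mul, norm_mul, norm_mul, h₁, h₄, norm_real, Real.norm_of_nonneg hR.le, mul_one] at this
    exact mul_right_cancel₀ hR.ne' (by rw [this, one_mul])
  by_cases z1 : z₁ = 0
  -- If both vanished, both heights would be imaginary and `a₄ / a₁` real.
  · have z4 : z₄ ≠ 0 := by
      rintro rfl
      apply hX
      rw [div_im, ra₁, ra₄, z1]
      simp
    have w4 : w₄ = 0 := by simpa [z1] using n₄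
    have w1 : w₁ ≠ 0 := by
      rintro rfl
      simp at n₁
      exact z4 (by simpa using n₁.symm)
    have hz4 : ‖z₄‖ ≠ 0 := norm_ne_zero_iff.mpr z4
    have hw1 : ‖w₁‖ ≠ 0 := norm_ne_zero_iff.mpr w1
    have hl : a₄ / (R * a₁) / (w₁ / z₄) * (w₁ / z₄) * (R * a₁) = a₄ := by field_simp
    have hl4 : ‖w₁ / z₄‖ ^ 2 * R = 1 := by
      rw [norm_div, div_pow]; field_simp; linarith
    refine ⟨_, w₁ / z₄, ?_, hl4, ?_, by field_simp, hl, Or.inl (by simp [z1])⟩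
    · have := hprod hl
      have h2 : (‖a₄ / (R * a₁) / (w₁ / z₄)‖ * ‖w₁ / z₄‖) ^ 2 * R = R := by rw [this]; ring
      rw [mul_pow, mul_assoc, hl4, mul_one] at h2
      exact h2
    · rw [z1, w4, mul_zero]
  have hz1 : ‖z₁‖ ≠ 0 := norm_ne_zero_iff.mpr z1
  have w4 : w₄ ≠ 0 := by
    rintro rfl
    simp [hR.ne'] at n₄
    exact z1 n₄
  have hl1 : ‖w₄ / z₁‖ ^ 2 = R := by
    rw [norm_div, div_pow, n₄]; field_simp
  have hl4 : ∀ {l : ℂ}, w₄ / z₁ * l * (R * a₁) = a₄ → ‖l‖ ^ 2 * R = 1 := by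
    intro l h
    rw [← hl1, ← mul_pow, mul_comm, hprod h, one_pow]
  by_cases z4 : z₄ = 0
  · have w1 : w₁ = 0 := by
      simpa [z4, hR.ne'] using n₁
    have hl : w₄ / z₁ * (a₄ / (R * a₁) / (w₄ / z₁)) * (R * a₁) = a₄ := by field_simp
    exact ⟨w₄ / z₁, _, hl1, hl4 hl, by field_simp, by rw [z4, w1, mul_zero], hl,
      Or.inl (by simp [z4])⟩
  have w1 : w₁ ≠ 0 := by
    rintro rfl
    simp at n₁
    exact z4 (by simpa using n₁.symm)
  have w1' : conj w₁ ≠ 0 := by simpa using w1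
  -- The phase condition enters as the statement that `z K` is real.
  have N : ∀ {z K : ℂ}, z ≠ 0 → K ≠ 0 → z * ‖K‖ = -(‖z‖ * conj K) →
      z * K = conj z * conj K := by
    intro z K hz0 hK h
    have hc := congrArg conj h
    simp only [map_mul, map_neg, conj_ofReal, conj_conj] at hc
    have hK' : (‖K‖ : ℂ) ≠ 0 := by simpa using hK
    apply mul_right_cancel₀ hK'
    linear_combination K * h - conj K * hc
  have N₁ := N z1 hH hz
  have N₂ := N w1 hH' hw
  have hHc : conj H ≠ 0 := by simpa using hH
  have hHc' : conj H' ≠ 0 := by simpa using hH'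
  rw [div_eq_div_iff hH hH'] at hX₁ hY
  have hX₁c := congrArg conj hX₁
  simp only [map_mul, conj_conj] at hX₁c
  have hl : w₄ / z₁ * (w₁ / z₄) * (R * a₁) = a₄ := by
    have k : w₄ * w₁ * conj H = z₄ * z₁ * conj H' := by
      apply mul_right_cancel₀ (mul_ne_zero hH hH')
      linear_combination w₄ * H * conj H * N₂ - conj H * conj H' * hY - z₄ * conj H' * H' * N₁
    field_simp
    apply mul_right_cancel₀ hHc
    linear_combination R * a₁ * k + z₁ * z₄ * R * hX₁c + z₁ * z₄ * conj H * hb₁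
  refine ⟨w₄ / z₁, w₁ / z₄, hl1, hl4 hl, by field_simp, by field_simp, hl, Or.inr fun e he => ?_⟩
  have hn : (R : ℂ) * (w₁ * conj w₁) = z₄ * conj z₄ := by
    rw [Complex.mul_conj', Complex.mul_conj', ← ofReal_pow, ← ofReal_pow, ← n₁]
    push_cast
    ring
  have hb₁c := congrArg conj hb₁
  simp only [map_mul, conj_ofReal] at hb₁c
  have k : w₄ * conj w₁ = e * (z₁ * conj z₄) := by
    simp only [map_mul, conj_conj] at he
    apply mul_right_cancel₀ (mul_ne_zero (mul_ne_zero ha₁' ha₄) (mul_ne_zero hH hR0))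
    linear_combination (-H * R) * he - conj a₁ * a₄ * R * hY + z₄ * conj z₁ * a₄ * R * hX₁
      + z₄ * conj z₁ * a₄ * H * hb₁c + z₄ * conj z₁ * H * e₄
  field_simp
  apply mul_right_cancel₀ w1'
  linear_combination z₄ * k - e * z₁ * hn

/-! ### Passage between side-pairings and cross-ratios. -/

theorem isArgument_arg (x : ℂ) : IsArgument (arg x) x := (norm_mul_exp_arg_mul_I x).symm

theorem isArgument_zero (φ : ℝ) : IsArgument φ 0 := by simp [IsArgument]

theorem IsStretch.norm_eq_one_of_mul {g₁ g₄ : PU21} {l₁ l₄ : ℂ} {ψ : ℝ} (h₁ : l₁ ≠ 0)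
    (h₄ : l₄ ≠ 0) (hg₁ : IsStretch (g₁ : Equiv.Perm Boundary) l₁)
    (hg₄ : IsStretch (g₄ : Equiv.Perm Boundary) l₄)
    (h : IsConjugateTo (g₁ * g₄) (heisRotation ψ)) : ‖l₁‖ * ‖l₄‖ = 1 := by
  rw [← norm_mul]
  exact h.norm_eq_one (mul_ne_zero h₁ h₄) (hg₁.comp hg₄) (isStretch_heisRotation ψ)
    (norm_exp_ofReal_mul_I ψ)

theorem isStretch_loxodromic (φ r : ℝ) :
    IsStretch (heisRotation φ ∘ heisDilation r) (exp (φ * I) * r) :=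
  (isStretch_heisRotation φ).comp (isStretch_heisDilation r)

/-- Side-pairings of two standard quadruples determine the cross-ratios up to `𝒯`. -/
theorem IsStandard.involution_eq {q q' : Fin 4 → Boundary} {z w z' w' : ℂ} {t s t' s' : ℝ}
    (h : IsStandard q z t w s) (h' : IsStandard q' z' t' w' s') (hq : Function.Injective q)
    (h₁ : ‖heisHeight z t‖ = 1) (h₁' : ‖heisHeight z' t'‖ = 1) {g₁ g₄ : PU21} {l₁ l₄ : ℂ}
    (hl₁ : l₁ ≠ 0) (hl₄ : l₄ ≠ 0) (hg₁ : IsStretch (g₁ : Equiv.Perm Boundary) l₁)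
    (hg₄ : IsStretch (g₄ : Equiv.Perm Boundary) l₄)
    (k₁ : (g₁ : Equiv.Perm Boundary) (q 0) = q' 3)
    (k₄ : (g₄ : Equiv.Perm Boundary) (q 3) = q' 0) {ψ φ : ℝ}
    (c : IsConjugateTo (g₁ * g₄) (heisRotation ψ))
    (hφ : IsArgument φ ((1 - X₁ q - X₂ q) / (X₁ q ^ (1 / 2 : ℂ) * X₂ q ^ (1 / 2 : ℂ))))
    (d : IsConjugateTo (g₁ * g₄⁻¹) (heisRotation (2 * φ) ∘ heisDilation ‖X₃ q‖)) :
    involutionT (X₁ q, X₂ q, X₃ q) = (X₁ q', X₂ q', X₃ q') := by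
  obtain ⟨hz, hw, hP⟩ := h.height_ne_zero hq
  have hX₃ : ‖X₃ q‖ = ‖heisHeight w s‖ := by rw [h.X₃_eq, norm_div, h₁, div_one]
  rw [h.one_sub hq, h.X₁_eq, h.X₂_eq, mul_assoc] at hφ
  rw [h.1, hg₁.2, h'.2.2.2] at k₁
  rw [h.2.2.2, hg₄.2, h'.1] at k₄
  obtain ⟨rfl, rfl⟩ := heis_injective k₁
  obtain ⟨rfl, rfl⟩ := heis_injective k₄
  have hn := IsStretch.norm_eq_one_of_mul hl₁ hl₄ hg₁ hg₄ c
  rw [hX₃] at d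
  have hR : 0 < ‖heisHeight w s‖ := norm_pos_iff.mpr hw
  have he := exp_two_mul_of_isArgument h₁ rfl hR hP hφ
  -- Since `p₁'` is the image of `p₄`, its unit height reads `|l₄|² R = 1`; with `|l₁ l₄| = 1` this
  -- gives `|l₁|² = R`.
  rw [heisHeight_mul, norm_mul, norm_pow, norm_real, norm_norm] at h₁'
  set R := ‖heisHeight w s‖ with hRdef
  have hl₁R : ‖l₁‖ ^ 2 = R := by
    have : (‖l₁‖ * ‖l₄‖) ^ 2 * R = R := by rw [hn]; ring
    rwa [mul_pow, mul_assoc, h₁', mul_one] at this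
  have hR0 : (R : ℂ) ≠ 0 := ofReal_ne_zero.mpr hR.ne'
  have hl₄R : ‖l₄‖ ^ 2 = R⁻¹ := eq_inv_of_mul_eq_one_left h₁'
  have hl₄0 : ‖l₄‖ ≠ 0 := norm_ne_zero_iff.mpr hl₄
  have hquot : l₁ * l₄⁻¹ = exp ((2 * φ : ℝ) * I) * R := by
    refine d.eq_of_norm_eq (mul_ne_zero hl₁ (inv_ne_zero hl₄)) (hg₁.comp (hg₄.inv hl₄))
      (isStretch_loxodromic _ _) ?_
    rw [norm_mul, norm_exp_ofReal_mul_I, one_mul, norm_real, norm_mul, norm_inv,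
      Real.norm_of_nonneg hR.le, ← hl₁R]
    field_simp
    linear_combination hn
  have hl₁' : l₁ * conj l₄ = exp ((2 * φ : ℝ) * I) := by
    have e1 : l₁ = exp ((2 * φ : ℝ) * I) * R * l₄ := by
      rw [← hquot]; field_simp
    rw [e1, mul_assoc, Complex.mul_conj', ← ofReal_pow, hl₄R]
    push_cast
    field_simp
  have hc := heisProd_transform h₁ hRdef.symm hR he
  have hP' : heisProd (l₄ * w) (‖l₄‖ ^ 2 * s) (l₁ * z) (‖l₁‖ ^ 2 * t) =
      R * heisHeight z t + 2 * (exp ((2 * φ : ℝ) * I) * conj (w * conj z)) +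
        conj (heisHeight w s) / R := by
    rw [heisProd, heisHeight_mul, heisHeight_mul, ← ofReal_pow, ← ofReal_pow, hl₁R, hl₄R, ← hl₁']
    simp only [map_mul, conj_conj, conj_ofReal]
    push_cast
    ring
  rw [← hP'] at hc
  have hPe : heisProd z t w s = heisHeight w s + 2 * (w * conj z) + conj (heisHeight z t) := by
    rw [heisProd]; ring
  rw [← hPe] at hc
  have e₁ : heisHeight z t * conj (heisHeight z t) = 1 := by
    simpa using mul_conj_of_norm_eq h₁
  have e₄ := mul_conj_of_norm_eq hRdef.symm
  have hz' := right_ne_zero_of_mul_eq_one e₁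
  have hP0 : heisProd (l₄ * w) (‖l₄‖ ^ 2 * s) (l₁ * z) (‖l₁‖ ^ 2 * t) ≠ 0 := by
    intro h0
    rw [h0, zero_mul] at hc
    exact mul_ne_zero hR0 hP hc.symm
  rw [h.X₁_eq, h.X₂_eq, h.X₃_eq, h'.X₁_eq, h'.X₂_eq, h'.X₃_eq]
  generalize heisProd (l₄ * w) (‖l₄‖ ^ 2 * s) (l₁ * z) (‖l₁‖ ^ 2 * t) = K at hc hP0 ⊢
  rw [heisHeight_mul, heisHeight_mul, ← ofReal_pow, ← ofReal_pow, hl₁R, hl₄R]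
  simp only [involutionT, Prod.mk.injEq, star_def, map_mul, conj_ofReal, map_div₀]
  push_cast
  refine ⟨?_, ?_, ?_⟩
  · rw [div_eq_div_iff hP hP0]
    field_simp
    apply mul_right_cancel₀ hw
    linear_combination R * hc - heisProd z t w s * e₄
  · rw [div_eq_div_iff hP hP0]
    apply mul_right_cancel₀ hz'
    linear_combination hc - R * heisProd z t w s * e₁
  · rw [div_eq_div_iff hz' (by simp [hw, hR.ne'])]
    field_simp
    linear_combination e₄ - R ^ 2 * e₁

/-- Standard quadruples with cross-ratios related by `𝒯` admit side-pairings. -/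
theorem IsStandard.exists_pairing {q q' : Fin 4 → Boundary} {z w z' w' : ℂ} {t s t' s' : ℝ}
    (h : IsStandard q z t w s) (h' : IsStandard q' z' t' w' s') (hq : Function.Injective q)
    (hq' : Function.Injective q')
    (h₁ : ‖heisHeight z t‖ = 1) (h₁' : ‖heisHeight z' t'‖ = 1)
    (h₂ : z * ‖heisProd z t w s‖ = -(‖z‖ * conj (heisProd z t w s)))
    (h₂' : z' * ‖heisProd z' t' w' s'‖ = -(‖z'‖ * conj (heisProd z' t' w' s')))
    (hX : (X₃ q).im ≠ 0)
    (hT : involutionT (X₁ q, X₂ q, X₃ q) = (X₁ q', X₂ q', X₃ q')) :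
    ∃ g₁ g₄ : PU21,
      ((g₁ : Equiv.Perm Boundary) (q 1) = q' 1 ∧ (g₁ : Equiv.Perm Boundary) (q 2) = q' 2 ∧
        (g₄ : Equiv.Perm Boundary) (q 1) = q' 1 ∧ (g₄ : Equiv.Perm Boundary) (q 2) = q' 2 ∧
        (g₁ : Equiv.Perm Boundary) (q 0) = q' 3 ∧
        (g₄ : Equiv.Perm Boundary) (q 3) = q' 0) ∧
      IsConjugateTo (g₁ * g₄) (heisRotation (arg (X₃ q))) ∧
      ∃ φ : ℝ, IsArgument φ ((1 - X₁ q - X₂ q) / (X₁ q ^ (1 / 2 : ℂ) * X₂ q ^ (1 / 2 : ℂ))) ∧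
        IsConjugateTo (g₁ * g₄⁻¹) (heisRotation (2 * φ) ∘ heisDilation ‖X₃ q‖) := by
  obtain ⟨hz, hw, hP⟩ := h.height_ne_zero hq
  obtain ⟨hz', hw', hP'⟩ := h'.height_ne_zero hq'
  have hX₃ : ‖X₃ q‖ = ‖heisHeight w s‖ := by rw [h.X₃_eq, norm_div, h₁, div_one]
  have hR : 0 < ‖heisHeight w s‖ := norm_pos_iff.mpr hw
  have hR0 : (‖heisHeight w s‖ : ℂ) ≠ 0 := ofReal_ne_zero.mpr hR.ne'
  simp only [involutionT, Prod.mk.injEq, star_def] at hT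
  obtain ⟨hT₁, hT₂, hT₃⟩ := hT
  have hY : w * conj z / heisProd z t w s = w' * conj z' / heisProd z' t' w' s' := by
    have e : 1 - X₁ q - X₂ q = 1 - X₁ q' - X₂ q' := by rw [hT₁, hT₂]
    rw [h.one_sub hq, h'.one_sub hq', mul_assoc, mul_assoc, mul_div_assoc 2, mul_div_assoc 2] at e
    exact mul_left_cancel₀ two_ne_zero e
  rw [h.X₁_eq, h'.X₁_eq] at hT₁
  rw [h.X₂_eq, h'.X₂_eq] at hT₂
  have hX' := hX
  rw [h.X₃_eq] at hX'
  rw [h.X₃_eq, h'.X₃_eq] at hT₃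
  have hneg : ∀ (x : ℂ) (r : ℝ), (heisHeight x r).re ≤ 0 := fun x r => by
    rw [heisHeight_re]; simp
  obtain ⟨hb₁, hb₄⟩ := height_eq_of_involution h₁ rfl h₁' hR hP hP' (hneg _ _) (hneg _ _)
    (hneg _ _) (hneg _ _) hX' hT₁ hT₂ hT₃
  obtain ⟨l₁, l₄, n₁, n₄, m₁, m₄, hl, hor⟩ := exists_stretch_factors h₁ rfl hR hP hP'
    (heisHeight_re _ _) (heisHeight_re _ _) (heisHeight_re _ _) (heisHeight_re _ _) hX' hb₁ hb₄
    hT₁ hY h₂ h₂'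
  have hl₁ : l₁ ≠ 0 := by
    rintro rfl
    rw [norm_zero] at n₁
    simp [← n₁] at hR
  have hl₄ : l₄ ≠ 0 := by
    rintro rfl
    simp at n₄
  obtain ⟨g₁, hg₁⟩ := PU21_exists_of_isStretch l₁ hl₁
  obtain ⟨g₄, hg₄⟩ := PU21_exists_of_isStretch l₄ hl₄
  have hfix : ∀ {g : PU21} {l : ℂ}, IsStretch (g : Equiv.Perm Boundary) l →
      (g : Equiv.Perm Boundary) (q 1) = q' 1 ∧ (g : Equiv.Perm Boundary) (q 2) = q' 2 := by
    intro g l hg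
    rw [h.2.1, h'.2.1, h.2.2.1, h'.2.2.1, hg.1, hg.2]
    simp
  refine ⟨g₁, g₄, ⟨(hfix hg₁).1, (hfix hg₁).2, (hfix hg₄).1, (hfix hg₄).2, ?_, ?_⟩, ?_, ?_⟩
  · rw [h.1, h'.2.2.2, hg₁.2, m₁, n₁]
    have e := congrArg im hb₄
    rw [im_ofReal_mul, heisHeight_im, heisHeight_im] at e
    rw [e]
  · rw [h.2.2.2, h'.1, hg₄.2, m₄]
    have e := congrArg im hb₁
    rw [im_mul_ofReal, heisHeight_im, heisHeight_im] at e
    rw [← e, mul_comm t', ← mul_assoc, n₄, one_mul]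
  -- The product of the factors is `X₃ / |X₃|`.
  · have e : l₁ * l₄ = exp (arg (X₃ q) * I) := by
      have hn := norm_mul_exp_arg_mul_I (X₃ q)
      rw [hX₃] at hn
      apply mul_left_cancel₀ hR0
      rw [hn, h.X₃_eq, eq_div_iff hz]
      linear_combination hl
    refine IsConjugateTo.of_isStretch (l := l₁ * l₄) (hg₁.comp hg₄) ?_
    rw [e]
    exact isStretch_heisRotation _
  · suffices ∃ φ : ℝ,
        IsArgument φ ((1 - X₁ q - X₂ q) / (X₁ q ^ (1 / 2 : ℂ) * X₂ q ^ (1 / 2 : ℂ))) ∧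
          l₁ = exp ((2 * φ : ℝ) * I) * ‖heisHeight w s‖ * l₄ by
      obtain ⟨φ, hφ, e⟩ := this
      refine ⟨φ, hφ, IsConjugateTo.of_isStretch (l := l₁ * l₄⁻¹) (hg₁.comp (hg₄.inv hl₄)) ?_⟩
      rw [e, mul_inv_cancel_right₀ hl₄, hX₃]
      exact isStretch_loxodromic _ _
    rw [h.one_sub hq, h.X₁_eq, h.X₂_eq, mul_assoc 2]
    rcases hor with h0 | hall
    -- Here `1 - X₁ - X₂ = 0`, every `φ` is admissible, and `φ` is read off from the quotient of the
    -- factors.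
    · refine ⟨arg (l₁ / l₄) / 2, by rw [h0]; simpa using isArgument_zero _, ?_⟩
      have hn := norm_mul_exp_arg_mul_I (l₁ / l₄)
      have hnorm : ‖l₁ / l₄‖ = ‖heisHeight w s‖ := by
        have h4 : ‖l₄‖ ≠ 0 := norm_ne_zero_iff.mpr hl₄
        have : ‖l₁ / l₄‖ ^ 2 = ‖heisHeight w s‖ ^ 2 := by
          rw [norm_div, div_pow, n₁]
          field_simp
          linear_combination -n₄
        exact (pow_left_inj₀ (norm_nonneg _) (norm_nonneg _) two_ne_zero).mp this
      rw [hnorm] at hn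
      rw [mul_div_cancel₀ _ two_ne_zero, mul_comm (exp _), hn, div_mul_cancel₀ _ hl₄]
    · exact ⟨_, isArgument_arg _,
        hall _ (exp_two_mul_of_isArgument h₁ rfl hR hP (isArgument_arg _))⟩

end ComplexHyperbolic

open ComplexHyperbolic

theorem mainTheorem3 (p p' : Fin 4 → Boundary)
    (hp : Function.Injective p) (hp' : Function.Injective p')
    (hC : ¬ ∃ C : Set Boundary, IsCCircle C ∧ ∀ i, p i ∈ C)
    (hC' : ¬ ∃ C : Set Boundary, IsCCircle C ∧ ∀ i, p' i ∈ C)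
    (hX : (X₃ p).im ≠ 0) (hX' : (X₃ p').im ≠ 0) :
    (∃ q, SameConfiguration p q ∧ IsNormalised q) ∧
    (∃ q', SameConfiguration p' q' ∧ IsNormalised q') ∧
    ∀ q q' : Fin 4 → Boundary,
      SameConfiguration p q → IsNormalised q →
      SameConfiguration p' q' → IsNormalised q' →
      (involutionT (X₁ p, X₂ p, X₃ p) = (X₁ p', X₂ p', X₃ p') ↔
        ∃ g₁ g₄ : PU21,
          ((g₁ : Equiv.Perm Boundary) (q 1) = q' 1 ∧ (g₁ : Equiv.Perm Boundary) (q 2) = q' 2 ∧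
            (g₄ : Equiv.Perm Boundary) (q 1) = q' 1 ∧ (g₄ : Equiv.Perm Boundary) (q 2) = q' 2 ∧
            (g₁ : Equiv.Perm Boundary) (q 0) = q' 3 ∧
            (g₄ : Equiv.Perm Boundary) (q 3) = q' 0) ∧
          IsConjugateTo (g₁ * g₄) (heisRotation (Complex.arg (X₃ p))) ∧
          ∃ φ : ℝ,
            IsArgument φ ((1 - X₁ p - X₂ p) /
              (X₁ p ^ (1 / 2 : ℂ) * X₂ p ^ (1 / 2 : ℂ))) ∧
            IsConjugateTo (g₁ * g₄⁻¹) (heisRotation (2 * φ) ∘ heisDilation ‖X₃ p‖)) := by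
  refine ⟨exists_isNormalised hp, exists_isNormalised hp', fun q q' hq hnq hq' hnq' => ?_⟩
  have hi := hq.injective hp
  have hi' := hq'.injective hp'
  obtain ⟨e₁, e₂, e₃⟩ := hq.X_eq
  obtain ⟨e₁', e₂', e₃'⟩ := hq'.X_eq
  rw [← e₃] at hX
  rw [← e₁, ← e₂, ← e₃, ← e₁', ← e₂', ← e₃']
  obtain ⟨z, t, w, s, h, h₁, h₂⟩ := hnq.exists_isStandard hi
  obtain ⟨z', t', w', s', h', h₁', h₂'⟩ := hnq'.exists_isStandard hi'
  constructor
  · exact h.exists_pairing h' hi hi' h₁ h₁' h₂ h₂' hX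
  · rintro ⟨g₁, g₄, ⟨k₁, k₂, k₃, k₄, k₅, k₆⟩, c, φ, hφ, d⟩
    rw [h.2.1, h'.2.1] at k₁ k₃
    rw [h.2.2.1, h'.2.2.1] at k₂ k₄
    obtain ⟨l₁, hl₁, hg₁⟩ := PU21_exists_isStretch g₁ k₁ k₂
    obtain ⟨l₄, hl₄, hg₄⟩ := PU21_exists_isStretch g₄ k₃ k₄
    exact h.involution_eq h' hi h₁ h₁' hl₁ hl₄ hg₁ hg₄ k₅ k₆ c hφ d
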